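/- Let $k\ge 1$ be an integer. For integers $n\ge 1$, let $\mathbf{G}\in\bigotimes^k\mathbb{R}^n$ be a random tensor with i.i.d. $\mathsf{N}(0,1)$ entries, and let $$\mathbf{Z}=\frac{1}{k!}\sqrt{\frac kn}\sum_{\pi\in\mathfrak{S}_k}\mathbf{G}^{\pi},\qquad \mathbf{G}^\pi_{i_1,\dots,i_k}=\mathbf{G}_{i_{\pi(1)},\dots,i_{\pi(k)}}$$ be the symmetric standard normal noise tensor. For $0\le q\le k$, let $\mathrm{Mat}_q(\mathbf{Z})\in\mathbb{R}^{n^q\times n^{k-q}}$ be the unfolding $[\mathrm{Mat}_q(\mathbf{Z})]_{a,b}=\mathbf{Z}_{i_1,\dots,i_k}$, where $a=1+\sum_{j=1}^q(i_j-1)n^{j-1}$ and $b=1+\sum_{j=q+1}^k(i_j-1)n^{j-q-1}$, and let $\|\cdot\|_{op}$ be the matrix operator norm with respect to the Euclidean norms. Then there is a constant $C_k>0$ depending only on $k$ such that the following hold. (a) For all $n\ge 1$ and all $0\le q\le k$, the random variable $\|\mathrm{Mat}_q(\mathbf{Z})\|_{op}$ is integrable and $$\frac{1}{\sqrt{(k-1)!}}\,n^{\max(q-1,k-q-1)/2}\Big(1-\frac{C_k}{n^{\max(q,k-q)}}\Big)\le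 \mathbb{E}\|\mathrm{Mat}_q(\mathbf{Z})\|_{op}\le \sqrt{k}\,\big(n^{(q-1)/2}+n^{(k-q-1)/2}\big).$$ (b) For all $n$ large enough (depending on $k$), both the lower bound and the upper bound in (a), as functions of $q\in\{0,\dots,k\}$, attain their minimum at $q=\lceil k/2\rceil$. (c) For all $n\ge1$, all $0\le q\le k$ and all $t\ge 0$, $$\mathbb{P}\Big\{\big|\|\mathrm{Mat}_q(\mathbf{Z})\|_{op}-\mathbb{E}\|\mathrm{Mat}_q(\mathbf{Z})\|_{op}\big|\ge t\Big\}\le 2e^{-nt^2/(2k)}.$$ -/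

import Mathlib

open MeasureTheory ProbabilityTheory Filter
open scoped Nat

namespace TensorUnfolding

/-- Real tensors of order `k` on `ℝⁿ`, given by their coordinates `X_{i₁,…,i_k}`. -/
abbrev Tensor (k n : ℕ) : Type := (Fin k → Fin n) → ℝ

/-- The tensor `X^π`, whose entry at `(i₁,…,i_k)` is the entry of `X` at `(i_{π(1)},…,i_{π(k)})`. -/
def permute {k n : ℕ} (π : Equiv.Perm (Fin k)) (X : Tensor k n) : Tensor k n :=
  fun i => X (fun j => i (π j))

/-- The symmetrized and rescaled tensor `(1/k!) √(k/n) ∑_π G^π`. It is the symmetric standard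
normal noise tensor when `G` has independent standard normal entries. -/
noncomputable def symNoise {k n : ℕ} (G : Tensor k n) : Tensor k n :=
  (1 / (k ! : ℝ) * √((k : ℝ) / (n : ℝ))) • ∑ π : Equiv.Perm (Fin k), permute π G

/-- `G` is, under the measure `P`, a random tensor with independent `N(0,1)` entries. -/
structure IsStdGaussianTensor {Ω : Type*} [MeasurableSpace Ω] {k n : ℕ}
    (G : Ω → Tensor k n) (P : Measure Ω) : Prop where
  hasLaw : ∀ i : Fin k → Fin n, HasLaw (fun ω => G ω i) (gaussianReal 0 1) P
  indep : iIndepFun (fun (i : Fin k → Fin n) (ω : Ω) => G ω i) P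

/-- The unfolding `Mat_q : ⊗ᵏ ℝⁿ → ℝ^{n^q × n^{k-q}}` (for `q ≤ k`). The first `q` indices of the
tensor are the base-`n` digits of the row index and the last `k - q` indices are those of the
column index: `finFunctionFinEquiv` sends `f` to `∑ j, f j * n ^ j` (everything is numbered
from `0`). -/
def unfolding {k n : ℕ} (q : ℕ) (X : Tensor k n) : Matrix (Fin (n ^ q)) (Fin (n ^ (k - q))) ℝ :=
  Matrix.of fun a b => X fun j : Fin k =>
    if h : (j : ℕ) < q then finFunctionFinEquiv.symm a ⟨j, h⟩
    else finFunctionFinEquiv.symm b ⟨j - q, by omega⟩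

/-- The operator norm of a matrix with respect to the Euclidean norms (largest singular value). -/
noncomputable def opNorm {m p : ℕ} (A : Matrix (Fin m) (Fin p) ℝ) : ℝ :=
  ‖LinearMap.toContinuousLinearMap (Matrix.toEuclideanLin A)‖

/-- `‖Mat_q(Z)‖_op`, where `Z` is the symmetric noise tensor built from `G`. -/
noncomputable def noiseNorm {k n : ℕ} (q : ℕ) (G : Tensor k n) : ℝ :=
  opNorm (unfolding q (symNoise G))

/-- `(1/√((k-1)!)) n^{max(q-1, k-q-1)/2} (1 - C / n^{max(q, k-q)})`, for `1 ≤ k`. -/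
noncomputable def lowerBound (C : ℝ) (k n q : ℕ) : ℝ :=
  1 / √((k - 1)! : ℝ) * (n : ℝ) ^ (max ((q : ℝ) - 1) ((k : ℝ) - q - 1) / 2) *
    (1 - C / (n : ℝ) ^ max (q : ℝ) ((k : ℝ) - q))

/-- `√k (n^{(q-1)/2} + n^{(k-q-1)/2})`. -/
noncomputable def upperBound (k n q : ℕ) : ℝ :=
  √(k : ℝ) * ((n : ℝ) ^ (((q : ℝ) - 1) / 2) + (n : ℝ) ^ (((k : ℝ) - q - 1) / 2))

end TensorUnfolding

/-!
The dilations `√s • X` of a centred Gaussian vector `X` form a convolution semigroup, so passing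
from `s = 0` to `s = 1` can be cut into many small independent increments, along each of which a
second order Taylor expansion has a remainder of order `s ^ (3 / 2)` that disappears in the limit.
Applied to `exp ∘ h` this yields the sharp concentration inequality for an `L`-Lipschitz `h`, with
variance proxy `L ^ 2`; applied to `log ∑ exp`, whose second derivative sees only the increments of
the process, it yields the Sudakov–Fernique comparison of expected suprema.

The noise norm is the supremum over unit vectors `u`, `v` of linear forms in `G`, given by the
symmetrization of `u ⊗ v`, which has norm at most `√(k / n)`: this is the concentration. Since
`‖u ⊗ v - u' ⊗ v'‖ ^ 2 ≤ ‖u - u'‖ ^ 2 + ‖v - v'‖ ^ 2`, the process is dominated by the one attached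
to the pairs `(u, v)`: this is the upper bound. For the lower bound, the square of the operator norm
dominates the squared length of a row or a column, and concentration bounds the gap between second
moment and squared mean by `k / n`.
-/

namespace TensorUnfolding

section GaussianSemigroup

open scoped NNReal Topology

lemma le_of_forall_le_add_mul_sqrt_inv {a b K : ℝ}
    (h : ∀ m : ℕ, a ≤ b + K * √((m + 1 : ℝ)⁻¹)) : a ≤ b := by
  have hlim : Tendsto (fun m : ℕ => b + K * √((m + 1 : ℝ)⁻¹)) atTop (𝓝 (b + K * √0)) := by
    refine tendsto_const_nhds.add
      (tendsto_const_nhds.mul ((Real.continuous_sqrt.tendsto 0).comp ?_))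
    simpa only [one_div] using tendsto_one_div_add_atTop_nhds_zero_nat (𝕜 := ℝ)
  simpa using ge_of_tendsto' hlim h

variable {V : Type*} [NormedAddCommGroup V] [NormedSpace ℝ V] [MeasurableSpace V]
  {μ : Measure V}

/-- The law of `√s • X` when `X` has law `μ`. For a centred Gaussian measure `μ` these laws form a
convolution semigroup, see `dilate_conv_dilate`. -/
noncomputable def dilate (μ : Measure V) (s : ℝ≥0) : Measure V :=
  μ.map (√(s : ℝ) • ·)

lemma dilate_zero [IsProbabilityMeasure μ] : dilate μ 0 = Measure.dirac 0 := by
  simp [dilate]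

lemma dilate_one : dilate μ 1 = μ := by
  simp [dilate]

variable [BorelSpace V]

instance isGaussian_dilate [IsGaussian μ] (s : ℝ≥0) : IsGaussian (dilate μ s) :=
  isGaussian_map (√(s : ℝ) • ContinuousLinearMap.id ℝ V)

lemma variance_dilate (s : ℝ≥0) (ℓ : StrongDual ℝ V) : Var[ℓ; dilate μ s] = s * Var[ℓ; μ] := by
  rw [dilate, variance_map (by fun_prop) (by fun_prop), ← Real.sq_sqrt s.coe_nonneg,
    ← variance_const_mul, Real.sqrt_sq (Real.sqrt_nonneg _)]
  exact congrArg (Var[·; μ]) (funext fun x => by simp)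

variable [SecondCountableTopology V]

lemma integral_dilate {F : Type*} [NormedAddCommGroup F] [NormedSpace ℝ F] (s : ℝ≥0) {f : V → F}
    (hf : Continuous f) : ∫ x, f x ∂(dilate μ s) = ∫ x, f (√(s : ℝ) • x) ∂μ :=
  integral_map (by fun_prop) hf.aestronglyMeasurable

lemma integral_id_dilate (hμ : μ[id] = 0) (s : ℝ≥0) : (dilate μ s)[id] = 0 := by
  rw [integral_dilate s continuous_id]
  exact (integral_smul (√(s : ℝ)) (id : V → V)).trans (by rw [hμ, smul_zero])

variable [CompleteSpace V] [IsGaussian μ]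

lemma dilate_conv_dilate (hμ : μ[id] = 0) (s t : ℝ≥0) :
    dilate μ s ∗ dilate μ t = dilate μ (s + t) := by
  refine Measure.ext_of_charFunDual (funext fun ℓ => ?_)
  simp only [charFunDual_conv, IsGaussian.charFunDual_eq_of_integral_eq_zero
    (integral_id_dilate hμ _), variance_dilate, ← Complex.exp_add]
  congr 1
  push_cast
  ring

lemma integral_strongDual_sq (hμ : μ[id] = 0) (ℓ : StrongDual ℝ V) :
    ∫ x, ℓ x ^ 2 ∂μ = Var[ℓ; μ] := by
  rw [variance_of_integral_eq_zero (by fun_prop) ((IsGaussian.integral_dual ℓ).trans ?_)]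
  rw [show ∫ x, x ∂μ = 0 from hμ, map_zero]

lemma integrable_pow_norm_mul_exp_mul_norm (μ : Measure V) [IsGaussian μ] (j : ℕ) (a : ℝ) :
    Integrable (fun x : V => ‖x‖ ^ j * Real.exp (a * ‖x‖)) μ := by
  have hexp : ∀ b, Integrable (fun x : V => Real.exp (b * ‖x‖)) μ := by
    intro b
    obtain ⟨C, hC, h⟩ := IsGaussian.exists_integrable_exp_sq μ
    refine (h.const_mul (Real.exp (b ^ 2 / (4 * C)))).mono'
      (Continuous.aestronglyMeasurable (by fun_prop)) (ae_of_all _ fun x => ?_)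
    have hsq : b ^ 2 / (4 * C) + C * ‖x‖ ^ 2 - b * ‖x‖ = (b - 2 * C * ‖x‖) ^ 2 / (4 * C) := by
      field_simp
      ring
    rw [Real.norm_of_nonneg (Real.exp_pos _).le, ← Real.exp_add, Real.exp_le_exp, ← sub_nonneg, hsq]
    positivity
  simpa using integrable_pow_abs_mul_exp_of_mem_interior_integrableExpSet (X := fun x : V => ‖x‖)
    (v := a) (μ := μ) (by simp [integrableExpSet, hexp]) j

lemma integrable_pow_norm (μ : Measure V) [IsGaussian μ] (j : ℕ) :
    Integrable (fun x : V => ‖x‖ ^ j) μ := by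
  simpa using integrable_pow_norm_mul_exp_mul_norm μ j 0

end GaussianSemigroup

section Concentration

open scoped NNReal Topology

lemma exp_le_quadratic_add (y : ℝ) :
    Real.exp y ≤ 1 + y + y ^ 2 / 2 + |y| ^ 3 * Real.exp |y| := by
  have h := Complex.norm_exp_sub_sum_le_norm_mul_exp (y : ℂ) 3
  have hreal : Complex.exp y - ∑ m ∈ Finset.range 3, (y : ℂ) ^ m / m ! =
      ((Real.exp y - (1 + y + y ^ 2 / 2) : ℝ) : ℂ) := by
    simp [Finset.sum_range_succ, Nat.factorial]
  rw [hreal, Complex.norm_real, Complex.norm_real, Real.norm_eq_abs, Real.norm_eq_abs] at h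
  linarith [(le_abs_self _).trans h]

lemma exp_le_of_abs_sub_mul_le {ε a b S y : ℝ} (hε0 : 0 ≤ ε) (hε1 : ε ≤ 1) (hS : |S| ≤ a)
    (hy : |y| ≤ ε * a) (hyS : |y - ε * S| ≤ ε ^ 2 * b) :
    Real.exp y ≤ 1 + y + ε ^ 2 * S ^ 2 / 2 + ε ^ 3 * (a * b + a ^ 3 * Real.exp a) := by
  have ha : 0 ≤ a := (abs_nonneg S).trans hS
  have hsq : y ^ 2 - ε ^ 2 * S ^ 2 ≤ 2 * (ε ^ 3 * (a * b)) :=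
    calc y ^ 2 - ε ^ 2 * S ^ 2 = (y - ε * S) * (y + ε * S) := by ring
      _ ≤ |y - ε * S| * |y + ε * S| := (le_abs_self _).trans (abs_mul _ _).le
      _ ≤ ε ^ 2 * b * (ε * a + ε * a) := by
          refine mul_le_mul hyS ((abs_add_le _ _).trans (add_le_add hy ?_)) (abs_nonneg _)
            ((abs_nonneg _).trans hyS)
          rw [abs_mul, abs_of_nonneg hε0]
          gcongr
      _ = 2 * (ε ^ 3 * (a * b)) := by ring
  have hcube : |y| ^ 3 * Real.exp |y| ≤ ε ^ 3 * (a ^ 3 * Real.exp a) :=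
    calc |y| ^ 3 * Real.exp |y| ≤ (ε * a) ^ 3 * Real.exp a := by
          gcongr
          exact hy.trans (mul_le_of_le_one_left ha hε1)
      _ = ε ^ 3 * (a ^ 3 * Real.exp a) := by ring
  linarith [exp_le_quadratic_add y]

lemma lipschitzWith_integral_comp_add {V F : Type*} [NormedAddCommGroup V] [MeasurableSpace V]
    {L : ℝ≥0} [NormedAddCommGroup F] [NormedSpace ℝ F]
    {f : V → F} (hf : LipschitzWith L f) {μ : Measure V} [IsProbabilityMeasure μ]
    (hint : ∀ x, Integrable (fun z => f (x + z)) μ) :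
    LipschitzWith L fun x => ∫ z, f (x + z) ∂μ := by
  refine LipschitzWith.of_dist_le_mul fun x y => ?_
  rw [dist_eq_norm, ← integral_sub (hint x) (hint y)]
  have hbound : ∀ z, ‖f (x + z) - f (y + z)‖ ≤ L * dist x y := fun z => by
    simpa [dist_eq_norm] using hf.dist_le_mul (x + z) (y + z)
  simpa using norm_integral_le_of_norm_le_const (μ := μ) (ae_of_all _ hbound)

variable {V : Type*} [NormedAddCommGroup V] [NormedSpace ℝ V] {L B : ℝ≥0} {h : V → ℝ}

/-- `h` is `L`-Lipschitz and continuously differentiable with `B`-Lipschitz derivative: the class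
of functions, stable under Gaussian averaging, along which the semigroup is expanded. -/
structure IsSmoothLipschitz (L B : ℝ≥0) (h : V → ℝ) : Prop where
  differentiable : Differentiable ℝ h
  lipschitz : LipschitzWith L h
  lipschitz_fderiv : LipschitzWith B (fderiv ℝ h)

/-- The coefficient of `s ^ (3 / 2)` in the bound for the remainder of the second order expansion
of `exp (h (√s • x))` at `s = 0`, for `h` an `IsSmoothLipschitz L B` function. -/
noncomputable def expRemainder (L B : ℝ≥0) (x : V) : ℝ :=
  L * B * ‖x‖ ^ 3 + L ^ 3 * (‖x‖ ^ 3 * Real.exp (L * ‖x‖))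

namespace IsSmoothLipschitz

lemma comp_const_add (hh : IsSmoothLipschitz L B h) (x : V) :
    IsSmoothLipschitz L B fun z => h (x + z) where
  differentiable := by have := hh.differentiable; fun_prop
  lipschitz := by simpa [Function.comp_def] using hh.lipschitz.comp (isometry_add_left x).lipschitz
  lipschitz_fderiv := by
    rw [show fderiv ℝ (fun z => h (x + z)) = fun z => fderiv ℝ h (x + z) from
      funext fun z => fderiv_comp_add_left x]
    simpa [Function.comp_def] using hh.lipschitz_fderiv.comp (isometry_add_left x).lipschitz

lemma abs_add_sub_le (hh : IsSmoothLipschitz L B h) (x y : V) :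
    |h (x + y) - h x| ≤ L * ‖y‖ := by
  simpa using hh.lipschitz.norm_sub_le (x + y) x

lemma abs_fderiv_apply_le (hh : IsSmoothLipschitz L B h) (x y : V) :
    |fderiv ℝ h x y| ≤ L * ‖y‖ :=
  (fderiv ℝ h x).le_of_opNorm_le (norm_fderiv_le_of_lipschitz ℝ hh.lipschitz) y

lemma abs_add_sub_sub_fderiv_le (hh : IsSmoothLipschitz L B h) (x y : V) :
    |h (x + y) - h x - fderiv ℝ h x y| ≤ B * ‖y‖ ^ 2 := by
  have hbound : ∀ z ∈ Metric.closedBall x ‖y‖, ‖fderiv ℝ h z - fderiv ℝ h x‖ ≤ B * ‖y‖ :=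
    fun z hz => (hh.lipschitz_fderiv.norm_sub_le z x).trans
      (mul_le_mul_of_nonneg_left (mem_closedBall_iff_norm.1 hz) B.2)
  have := (convex_closedBall x ‖y‖).norm_image_sub_le_of_norm_fderiv_le'
    (fun z _ => hh.differentiable z) hbound (Metric.mem_closedBall_self (norm_nonneg y))
    (y := x + y) (by simp)
  simpa [sq, mul_assoc] using this

lemma exp_sqrt_smul_le (hh : IsSmoothLipschitz L B h) {s : ℝ≥0} (hs : s ≤ 1) (x : V) :
    Real.exp (h (√(s : ℝ) • x)) ≤ Real.exp (h 0) * (1 + (h (√(s : ℝ) • x) - h 0) +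
      (s / 2 * fderiv ℝ h 0 x ^ 2 + s * √(s : ℝ) * expRemainder L B x)) := by
  set ε := √(s : ℝ)
  have hsq : (s : ℝ) = ε ^ 2 := (Real.sq_sqrt s.coe_nonneg).symm
  have hε : ‖ε • x‖ = ε * ‖x‖ := norm_smul_of_nonneg (Real.sqrt_nonneg _) x
  have hlip := hh.abs_add_sub_le 0 (ε • x)
  have hrem := hh.abs_add_sub_sub_fderiv_le 0 (ε • x)
  rw [zero_add, hε] at hlip hrem
  rw [map_smul, smul_eq_mul] at hrem
  have hexp := exp_le_of_abs_sub_mul_le (a := L * ‖x‖) (b := B * ‖x‖ ^ 2) (Real.sqrt_nonneg _)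
    (Real.sqrt_le_one.2 (by exact_mod_cast hs)) (hh.abs_fderiv_apply_le 0 x)
    (hlip.trans_eq (by ring)) (hrem.trans_eq (by ring))
  calc Real.exp (h (ε • x)) = Real.exp (h 0) * Real.exp (h (ε • x) - h 0) := by
        rw [← Real.exp_add, add_sub_cancel]
    _ ≤ _ := by
        gcongr
        rw [hsq, expRemainder]
        linarith

end IsSmoothLipschitz

variable [MeasurableSpace V] [BorelSpace V] [SecondCountableTopology V] [CompleteSpace V]

lemma integrable_of_lipschitzWith (μ : Measure V) [IsGaussian μ] (hh : LipschitzWith L h) :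
    Integrable h μ := by
  refine ((integrable_const |h 0|).add ((integrable_pow_norm μ 1).const_mul L)).mono'
    hh.continuous.aestronglyMeasurable (ae_of_all _ fun x => ?_)
  have := hh.norm_sub_le x 0
  simp only [sub_zero, Real.norm_eq_abs] at this
  simpa [add_comm |h 0|] using (abs_sub_abs_le_abs_sub (h x) (h 0)).trans this

lemma integrable_expRemainder (L B : ℝ≥0) (μ : Measure V) [IsGaussian μ] :
    Integrable (expRemainder L B) μ :=
  ((integrable_pow_norm μ 3).const_mul _).add
    ((integrable_pow_norm_mul_exp_mul_norm μ 3 L).const_mul _)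

lemma integrable_exp_of_lipschitzWith (μ : Measure V) [IsGaussian μ] (hh : LipschitzWith L h) :
    Integrable (fun x => Real.exp (h x)) μ := by
  have hint := (integrable_pow_norm_mul_exp_mul_norm μ 0 L).const_mul (Real.exp (h 0))
  refine hint.mono' (Real.continuous_exp.comp hh.continuous).aestronglyMeasurable
    (ae_of_all _ fun x => ?_)
  rw [Real.norm_of_nonneg (Real.exp_pos _).le, pow_zero, one_mul, ← Real.exp_add, Real.exp_le_exp]
  have := (le_abs_self _).trans (hh.norm_sub_le x 0)
  simp only [sub_zero] at this
  linarith

namespace IsSmoothLipschitz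

lemma integral_comp_add (hh : IsSmoothLipschitz L B h) (μ : Measure V) [IsGaussian μ] :
    IsSmoothLipschitz L B fun x => ∫ z, h (x + z) ∂μ := by
  have hint : ∀ x, Integrable (fun z => h (x + z)) μ :=
    fun x => integrable_of_lipschitzWith μ (hh.comp_const_add x).lipschitz
  have hbound : ∀ x, ‖fderiv ℝ h x‖ ≤ L := fun x => norm_fderiv_le_of_lipschitz ℝ hh.lipschitz
  have hcont := hh.lipschitz_fderiv.continuous
  have hint' : ∀ x, Integrable (fun z => fderiv ℝ h (x + z)) μ := fun x =>
    (integrable_const (L : ℝ)).mono' (by fun_prop) (ae_of_all _ fun z => hbound _)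
  have hderiv : ∀ x, HasFDerivAt (fun x => ∫ z, h (x + z) ∂μ) (∫ z, fderiv ℝ h (x + z) ∂μ) x :=
    fun x => hasFDerivAt_integral_of_dominated_of_fderiv_le univ_mem
      (.of_forall fun x => (hint x).aestronglyMeasurable) (hint x) (hint' x).aestronglyMeasurable
      (ae_of_all _ fun z x _ => hbound (x + z)) (integrable_const _) (ae_of_all _ fun z x _ =>
        (hasFDerivAt_comp_add_right z).2 (hh.differentiable (x + z)).hasFDerivAt)
  exact ⟨fun x => (hderiv x).differentiableAt, lipschitzWith_integral_comp_add hh.lipschitz hint,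
    (funext fun x => (hderiv x).fderiv) ▸ lipschitzWith_integral_comp_add hh.lipschitz_fderiv hint'⟩

end IsSmoothLipschitz

variable {μ : Measure V} [IsGaussian μ]

namespace IsSmoothLipschitz

lemma integral_exp_dilate_le_quadratic (hh : IsSmoothLipschitz L B h) {s : ℝ≥0} (hs : s ≤ 1) :
    ∫ x, Real.exp (h x) ∂(dilate μ s) ≤ Real.exp (h 0) * (1 + (∫ x, h x ∂(dilate μ s) - h 0) +
      (s / 2 * ∫ x, fderiv ℝ h 0 x ^ 2 ∂μ + s * √(s : ℝ) * ∫ x, expRemainder L B x ∂μ)) := by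
  have hcont := hh.lipschitz.continuous
  have hdil : LipschitzWith (L * ‖√(s : ℝ)‖₊) fun x => h (√(s : ℝ) • x) :=
    hh.lipschitz.comp (lipschitzWith_smul _)
  have hint := integrable_of_lipschitzWith μ hdil
  have hsub : Integrable (fun x => h (√(s : ℝ) • x) - h 0) μ := hint.sub (integrable_const _)
  have hadd : Integrable (fun x => 1 + (h (√(s : ℝ) • x) - h 0)) μ := (integrable_const _).add hsub
  have hsq : Integrable (fun x => fderiv ℝ h 0 x ^ 2) μ :=
    (IsGaussian.memLp_dual μ (fderiv ℝ h 0) 2 (by simp)).integrable_sq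
  have hrem := integrable_expRemainder L B μ
  have hquad : Integrable (fun x => s / 2 * fderiv ℝ h 0 x ^ 2 +
      s * √(s : ℝ) * expRemainder L B x) μ := (hsq.const_mul _).add (hrem.const_mul _)
  rw [integral_dilate s hcont, integral_dilate s (by fun_prop)]
  refine (integral_mono (integrable_exp_of_lipschitzWith μ hdil) ((hadd.add hquad).const_mul _)
    fun x => hh.exp_sqrt_smul_le hs x).trans_eq ?_
  rw [integral_const_mul]
  simp only [Pi.add_apply]
  rw [integral_add hadd hquad, integral_add (integrable_const _) hsub,
    integral_sub hint (integrable_const _), integral_add (hsq.const_mul _) (hrem.const_mul _),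
    integral_const_mul, integral_const_mul]
  simp

lemma integral_exp_dilate_le (hh : IsSmoothLipschitz L B h) (hμ : μ[id] = 0)
    (hvar : ∀ ℓ : StrongDual ℝ V, Var[ℓ; μ] ≤ ‖ℓ‖ ^ 2) {s : ℝ≥0} (hs : s ≤ 1) :
    ∫ x, Real.exp (h x) ∂(dilate μ s) ≤ Real.exp (∫ x, h x ∂(dilate μ s) +
      s * (L ^ 2 / 2 + (∫ x, expRemainder L B x ∂μ) * √(s : ℝ))) := by
  have hfderiv : ∫ x, fderiv ℝ h 0 x ^ 2 ∂μ ≤ L ^ 2 := by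
    rw [integral_strongDual_sq hμ]
    exact (hvar _).trans (by gcongr; exact norm_fderiv_le_of_lipschitz ℝ hh.lipschitz)
  refine (hh.integral_exp_dilate_le_quadratic hs).trans ?_
  set R := ∫ x, expRemainder L B x ∂μ
  set m := ∫ x, h x ∂(dilate μ s)
  calc Real.exp (h 0) * (1 + (m - h 0) +
        (s / 2 * ∫ x, fderiv ℝ h 0 x ^ 2 ∂μ + s * √(s : ℝ) * R))
      ≤ Real.exp (h 0) * Real.exp ((m - h 0) + (s / 2 * L ^ 2 + s * √(s : ℝ) * R)) := by
        gcongr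
        refine le_trans ?_ (Real.add_one_le_exp _)
        rw [add_comm _ (1 : ℝ), add_assoc]
        gcongr
    _ = _ := by
        rw [← Real.exp_add]
        congr 1
        ring

end IsSmoothLipschitz

lemma integral_exp_dilate_nsmul_le {s : ℝ≥0} {c : ℝ} (hμ : μ[id] = 0)
    (hstep : ∀ h : V → ℝ, IsSmoothLipschitz L B h →
      ∫ x, Real.exp (h x) ∂(dilate μ s) ≤ Real.exp (∫ x, h x ∂(dilate μ s) + c)) (m : ℕ)
    (hh : IsSmoothLipschitz L B h) :
    ∫ x, Real.exp (h x) ∂(dilate μ (m • s)) ≤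
      Real.exp (∫ x, h x ∂(dilate μ (m • s)) + m * c) := by
  induction m generalizing h with
  | zero => simp [dilate_zero]
  | succ m ih =>
    have hint := integrable_of_lipschitzWith (dilate μ ((m + 1) • s)) hh.lipschitz
    have hexp := integrable_exp_of_lipschitzWith (dilate μ ((m + 1) • s)) hh.lipschitz
    have hmean := hh.integral_comp_add (dilate μ s)
    rw [succ_nsmul, ← dilate_conv_dilate hμ] at hint hexp ⊢
    rw [integral_conv hint, integral_conv hexp]
    calc ∫ x, ∫ z, Real.exp (h (x + z)) ∂(dilate μ s) ∂(dilate μ (m • s))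
        ≤ ∫ x, Real.exp (∫ z, h (x + z) ∂(dilate μ s)) * Real.exp c ∂(dilate μ (m • s)) := by
          refine integral_mono_of_nonneg (ae_of_all _ fun x => by positivity)
            ((integrable_exp_of_lipschitzWith _ hmean.lipschitz).mul_const _)
            (ae_of_all _ fun x => ?_)
          simpa only [Real.exp_add] using hstep _ (hh.comp_const_add x)
      _ ≤ Real.exp (∫ x, ∫ z, h (x + z) ∂(dilate μ s) ∂(dilate μ (m • s)) + m * c) *
            Real.exp c := by
          rw [integral_mul_const]
          gcongr
          exact ih hmean
      _ = _ := by
          rw [← Real.exp_add]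
          push_cast
          ring_nf

lemma IsSmoothLipschitz.integral_exp_le (hh : IsSmoothLipschitz L B h) (hμ : μ[id] = 0)
    (hvar : ∀ ℓ : StrongDual ℝ V, Var[ℓ; μ] ≤ ‖ℓ‖ ^ 2) :
    ∫ x, Real.exp (h x) ∂μ ≤ Real.exp (∫ x, h x ∂μ + L ^ 2 / 2) := by
  rw [← Real.log_le_iff_le_exp (integral_exp_pos (integrable_exp_of_lipschitzWith μ hh.lipschitz))]
  refine le_of_forall_le_add_mul_sqrt_inv (K := ∫ x, expRemainder L B x ∂μ) fun m => ?_
  have hs1 : (m + 1 : ℝ≥0)⁻¹ ≤ 1 := inv_le_one_of_one_le₀ (by simp)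
  have hs : (m + 1) • (m + 1 : ℝ≥0)⁻¹ = 1 := by
    rw [nsmul_eq_mul, Nat.cast_succ, mul_inv_cancel₀ (by positivity)]
  have hiter := integral_exp_dilate_nsmul_le hμ
    (fun g (hg : IsSmoothLipschitz L B g) => hg.integral_exp_dilate_le hμ hvar hs1) (m + 1) hh
  rw [hs, dilate_one] at hiter
  rw [Real.log_le_iff_le_exp (integral_exp_pos (integrable_exp_of_lipschitzWith μ hh.lipschitz))]
  refine hiter.trans_eq (congrArg Real.exp ?_)
  push_cast
  field_simp
  ring

end Concentration

section Mollification

open scoped NNReal Convolution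

lemma lipschitzWith_convolution {E F F' G : Type*} [NormedAddCommGroup E]
    [NormedAddCommGroup F] [NormedSpace ℝ F] [NormedAddCommGroup F'] [NormedSpace ℝ F']
    [NormedAddCommGroup G] [NormedSpace ℝ G] [MeasurableSpace E] {ν : Measure E}
    {k : E → F} {f : E → F'} {L : ℝ≥0} (M : F →L[ℝ] F' →L[ℝ] G) (hk : Integrable k ν)
    (hkf : ConvolutionExists k f M ν) (hf : LipschitzWith L f) :
    LipschitzWith (‖M‖₊ * (∫ t, ‖k t‖ ∂ν).toNNReal * L) (k ⋆[M, ν] f) := by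
  refine LipschitzWith.of_dist_le_mul fun x y => ?_
  have hbound : ∀ t,
      ‖M (k t) (f (x - t)) - M (k t) (f (y - t))‖ ≤ ‖M‖ * (L * dist x y) * ‖k t‖ := by
    intro t
    have hdist := hf.dist_le_mul (x - t) (y - t)
    rw [dist_sub_right, dist_eq_norm (f _)] at hdist
    calc ‖M (k t) (f (x - t)) - M (k t) (f (y - t))‖ = ‖M (k t) (f (x - t) - f (y - t))‖ := by
          rw [map_sub]
      _ ≤ ‖M‖ * ‖k t‖ * ‖f (x - t) - f (y - t)‖ := M.le_opNorm₂ _ _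
      _ ≤ ‖M‖ * ‖k t‖ * (L * dist x y) := by gcongr
      _ = _ := by ring
  rw [dist_eq_norm, convolution_def, convolution_def, ← integral_sub (hkf x) (hkf y)]
  refine (norm_integral_le_of_norm_le (hk.norm.const_mul _) (ae_of_all _ hbound)).trans_eq ?_
  rw [integral_const_mul]
  push_cast
  rw [Real.coe_toNNReal _ (by positivity)]
  ring

lemma exists_isSmoothLipschitz_abs_sub_le {E : Type*} [NormedAddCommGroup E] [NormedSpace ℝ E]
    [FiniteDimensional ℝ E] {f : E → ℝ} {L : ℝ≥0} (hf : LipschitzWith L f) {δ : ℝ} (hδ : 0 < δ) :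
    ∃ (B : ℝ≥0) (g : E → ℝ), IsSmoothLipschitz L B g ∧ ∀ x, |g x - f x| ≤ δ := by
  borelize E
  let ν : Measure E := Measure.addHaar
  let ψ : ContDiffBump (0 : E) := ⟨δ / (2 * (L + 1)), δ / (L + 1), by positivity, by
    gcongr
    linarith [L.coe_nonneg]⟩
  have hcpt := ψ.hasCompactSupport_normed (μ := ν)
  have hψ : ContDiff ℝ 1 (ψ.normed ν) := ψ.contDiff_normed
  have hloc : LocallyIntegrable f ν := hf.continuous.locallyIntegrable
  have hderiv : ∀ x, HasFDerivAt (ψ.normed ν ⋆[.lsmul ℝ ℝ, ν] f)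
      ((fderiv ℝ (ψ.normed ν) ⋆[(ContinuousLinearMap.lsmul ℝ ℝ).precompL E, ν] f) x) x :=
    hcpt.hasFDerivAt_convolution_left _ hψ hloc
  have hψ' : Continuous (fderiv ℝ (ψ.normed ν)) := hψ.continuous_fderiv one_ne_zero
  have hlip' := lipschitzWith_convolution ((ContinuousLinearMap.lsmul ℝ ℝ).precompL E)
    (hψ'.integrable_of_hasCompactSupport (hcpt.fderiv (𝕜 := ℝ)))
    ((hcpt.fderiv (𝕜 := ℝ)).convolutionExists_left _ hψ' hloc) hf
  rw [← funext fun x => (hderiv x).fderiv] at hlip'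
  refine ⟨_, ψ.normed ν ⋆[.lsmul ℝ ℝ, ν] f, ⟨fun x => (hderiv x).differentiableAt, ?_, hlip'⟩,
    fun x => ?_⟩
  · refine (lipschitzWith_convolution _ (hψ.continuous.integrable_of_hasCompactSupport hcpt)
      (hcpt.convolutionExists_left _ hψ.continuous hloc) hf).weaken ?_
    simp only [Real.norm_of_nonneg (ψ.nonneg_normed _), ψ.integral_normed, Real.toNNReal_one,
      mul_one]
    exact mul_le_of_le_one_left' (ContinuousLinearMap.opNorm_lsmul_le)
  · refine ψ.dist_normed_convolution_le hf.continuous.aestronglyMeasurable fun y hy => ?_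
    refine (hf.dist_le_mul y x).trans ?_
    rw [Metric.mem_ball, lt_div_iff₀ (by positivity)] at hy
    nlinarith [dist_nonneg (x := y) (y := x)]

end Mollification

section SubGaussian

open scoped NNReal Topology

lemma one_add_sq_div_two_le_cosh (x : ℝ) : 1 + x ^ 2 / 2 ≤ Real.cosh x := by
  have hsinh : (x / 2) ^ 2 ≤ Real.sinh (x / 2) ^ 2 := by
    rw [sq_le_sq, Real.abs_sinh]
    exact Real.self_le_sinh_iff.2 (abs_nonneg _)
  have hcosh := Real.cosh_sq (x / 2)
  have hdouble := Real.cosh_two_mul (x / 2)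
  rw [mul_div_cancel₀ x two_ne_zero] at hdouble
  linarith

lemma exp_sub_one_le_mul_exp (x : ℝ) : Real.exp x - 1 ≤ x * Real.exp x := by
  have hinv : Real.exp (-x) * Real.exp x = 1 := by
    rw [← Real.exp_add, neg_add_cancel, Real.exp_zero]
  nlinarith [Real.add_one_le_exp (-x), Real.exp_pos x]

variable {Ω : Type*} [MeasurableSpace Ω] {μ : Measure Ω} {X : Ω → ℝ} {c : ℝ≥0}

lemma integral_sq_le_of_hasSubgaussianMGF [IsProbabilityMeasure μ] (hX : HasSubgaussianMGF X c μ) :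
    ∫ ω, X ω ^ 2 ∂μ ≤ c := by
  have hbound : ∀ t : ℝ, 0 < t → ∫ ω, X ω ^ 2 ∂μ ≤ c * Real.exp (c * t ^ 2 / 2) := by
    intro t ht
    have hplus := hX.integrable_exp_mul t
    have hminus := hX.integrable_exp_mul (-t)
    have hsq : Integrable (fun ω => t ^ 2 / 2 * X ω ^ 2) μ := (hX.memLp 2).integrable_sq.const_mul _
    have hmono : ∫ ω, (1 + t ^ 2 / 2 * X ω ^ 2) ∂μ ≤
        ∫ ω, (Real.exp (t * X ω) + Real.exp (-t * X ω)) / 2 ∂μ := by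
      refine integral_mono ((integrable_const _).add hsq)
        ((hplus.add hminus).div_const 2) fun ω => ?_
      have := one_add_sq_div_two_le_cosh (t * X ω)
      rw [Real.cosh_eq, ← neg_mul] at this
      exact le_of_eq_of_le (by ring) this
    rw [integral_add (integrable_const _) hsq,
      integral_const_mul, integral_div, integral_add hplus hminus] at hmono
    have hmgf : ∫ ω, Real.exp (t * X ω) ∂μ ≤ Real.exp (c * t ^ 2 / 2) := hX.mgf_le t
    have hmgf_neg : ∫ ω, Real.exp (-t * X ω) ∂μ ≤ Real.exp (c * t ^ 2 / 2) := by
      simpa only [even_two.neg_pow, mgf] using hX.mgf_le (-t)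
    have hexp := exp_sub_one_le_mul_exp (c * t ^ 2 / 2)
    simp only [integral_const, probReal_univ, one_smul] at hmono
    have : t ^ 2 / 2 * ∫ ω, X ω ^ 2 ∂μ ≤ t ^ 2 / 2 * (c * Real.exp (c * t ^ 2 / 2)) := by linarith
    exact le_of_mul_le_mul_left this (by positivity)
  have hlim : Tendsto (fun t : ℝ => c * Real.exp (c * t ^ 2 / 2)) (𝓝[>] 0) (𝓝 c) := by
    have : Continuous fun t : ℝ => c * Real.exp (c * t ^ 2 / 2) := by fun_prop
    simpa using this.continuousWithinAt (x := 0) (s := Set.Ioi 0) |>.tendsto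
  exact ge_of_tendsto hlim (eventually_nhdsWithin_of_forall hbound)

lemma measureReal_abs_ge_le_of_hasSubgaussianMGF (hX : HasSubgaussianMGF X c μ) {t : ℝ}
    (ht : 0 ≤ t) : μ.real {ω | t ≤ |X ω|} ≤ 2 * Real.exp (-t ^ 2 / (2 * c)) := by
  have hunion : {ω | t ≤ |X ω|} = {ω | t ≤ X ω} ∪ {ω | t ≤ (-X) ω} := by
    ext ω
    simp [le_abs]
  rw [hunion, two_mul]
  exact (measureReal_union_le _ _).trans
    (add_le_add (hX.measure_ge_le ht) (hX.neg.measure_ge_le ht))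

end SubGaussian

section GaussianConcentration

open scoped NNReal

variable {E : Type*} [NormedAddCommGroup E] [NormedSpace ℝ E] [FiniteDimensional ℝ E]
  [MeasurableSpace E] [BorelSpace E] {μ : Measure E} [IsGaussian μ] {L : ℝ≥0} {f : E → ℝ}

lemma integral_exp_le_of_lipschitzWith (hf : LipschitzWith L f) (hμ : μ[id] = 0)
    (hvar : ∀ ℓ : StrongDual ℝ E, Var[ℓ; μ] ≤ ‖ℓ‖ ^ 2) :
    ∫ x, Real.exp (f x) ∂μ ≤ Real.exp (∫ x, f x ∂μ + L ^ 2 / 2) := by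
  have hint := integrable_exp_of_lipschitzWith μ hf
  rw [← Real.log_le_iff_le_exp (integral_exp_pos hint)]
  refine le_of_forall_pos_le_add fun δ hδ => ?_
  obtain ⟨B, g, hg, hgf⟩ := exists_isSmoothLipschitz_abs_sub_le hf (half_pos hδ)
  rw [Real.log_le_iff_le_exp (integral_exp_pos hint)]
  have hfint := integrable_of_lipschitzWith μ hf
  calc ∫ x, Real.exp (f x) ∂μ
      ≤ ∫ x, Real.exp (g x) * Real.exp (δ / 2) ∂μ := by
        refine integral_mono hint ((integrable_exp_of_lipschitzWith μ hg.lipschitz).mul_const _)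
          fun x => ?_
        rw [← Real.exp_add, Real.exp_le_exp]
        linarith [(abs_le.1 (hgf x)).1]
    _ ≤ Real.exp (∫ x, g x ∂μ + L ^ 2 / 2) * Real.exp (δ / 2) := by
        rw [integral_mul_const]
        gcongr
        exact hg.integral_exp_le hμ hvar
    _ ≤ Real.exp (∫ x, (f x + δ / 2) ∂μ + L ^ 2 / 2) * Real.exp (δ / 2) := by
        gcongr
        · exact integrable_of_lipschitzWith μ hg.lipschitz
        · exact hfint.add (integrable_const _)
        · intro x
          linarith [(abs_le.1 (hgf x)).2]
    _ = _ := by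
        rw [integral_add hfint (integrable_const _), ← Real.exp_add]
        simp only [integral_const, probReal_univ, one_smul]
        ring_nf

lemma hasSubgaussianMGF_of_lipschitzWith (hf : LipschitzWith L f) (hμ : μ[id] = 0)
    (hvar : ∀ ℓ : StrongDual ℝ E, Var[ℓ; μ] ≤ ‖ℓ‖ ^ 2) :
    HasSubgaussianMGF (fun x => f x - ∫ y, f y ∂μ) (L ^ 2) μ := by
  have hlip : ∀ t : ℝ, LipschitzWith (‖t‖₊ * L) fun x => t * (f x - ∫ y, f y ∂μ) := fun t =>
    (lipschitzWith_smul t).comp (g := fun x => f x - ∫ y, f y ∂μ) (by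
      simpa using hf.sub (LipschitzWith.const (∫ y, f y ∂μ)))
  refine ⟨fun t => integrable_exp_of_lipschitzWith μ (hlip t), fun t => ?_⟩
  refine (integral_exp_le_of_lipschitzWith (hlip t) hμ hvar).trans_eq ?_
  rw [integral_const_mul, integral_sub (integrable_of_lipschitzWith μ hf) (integrable_const _)]
  simp [mul_pow, mul_comm]

end GaussianConcentration

section LogSumExp

variable {A : Type*} [Fintype A]

/-- The smooth maximum `log ∑ exp`, within `log |A|` of the maximum `⨆ a, w a`. -/
noncomputable def logSumExp (w : A → ℝ) : ℝ := Real.log (∑ a, Real.exp (w a))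

/-- The Gibbs weights `exp (w a) / ∑ exp (w b)`, which form the gradient of `logSumExp` at `w`. -/
noncomputable def softmax (w : A → ℝ) (a : A) : ℝ := Real.exp (w a) / ∑ b, Real.exp (w b)

/-- The mean of the observable `f` under the Gibbs weights of `w`. -/
noncomputable def gibbsMean (w f : A → ℝ) : ℝ := ∑ a, softmax w a * f a

/-- The variance of the observable `f` under the Gibbs weights of `w`; this is the second derivative
of `logSumExp` at `w` in the direction `f`. -/
noncomputable def gibbsVar (w f : A → ℝ) : ℝ := gibbsMean w (f * f) - gibbsMean w f * gibbsMean w f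

lemma softmax_nonneg (w : A → ℝ) (a : A) : 0 ≤ softmax w a := by
  unfold softmax; positivity

lemma hasDerivAt_sum_exp_line (w y : A → ℝ) (s : ℝ) :
    HasDerivAt (fun s : ℝ => ∑ a, Real.exp ((w + s • y) a))
      (∑ a, Real.exp ((w + s • y) a) * y a) s := by
  refine HasDerivAt.fun_sum fun a _ => ?_
  simpa using (((hasDerivAt_id s).mul_const (y a)).const_add (w a)).exp

variable [Nonempty A]

lemma sum_exp_pos (w : A → ℝ) : 0 < ∑ a, Real.exp (w a) :=
  Finset.sum_pos (fun _ _ => Real.exp_pos _) Finset.univ_nonempty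

lemma sum_softmax (w : A → ℝ) : ∑ a, softmax w a = 1 := by
  simp only [softmax]
  rw [← Finset.sum_div, div_self (sum_exp_pos w).ne']

lemma abs_gibbsMean_le (w f : A → ℝ) : |gibbsMean w f| ≤ ‖f‖ :=
  calc |gibbsMean w f| ≤ ∑ a, |softmax w a * f a| := Finset.abs_sum_le_sum_abs _ _
    _ ≤ ∑ a, softmax w a * ‖f‖ := by
        refine Finset.sum_le_sum fun a _ => ?_
        rw [abs_mul, abs_of_nonneg (softmax_nonneg w a)]
        exact mul_le_mul_of_nonneg_left (norm_le_pi_norm f a) (softmax_nonneg w a)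
    _ = ‖f‖ := by rw [← Finset.sum_mul, sum_softmax, one_mul]

lemma gibbsVar_eq_sum_sub_sq (w f : A → ℝ) :
    gibbsVar w f = 2⁻¹ * ∑ a, ∑ b, softmax w a * softmax w b * (f a - f b) ^ 2 := by
  have hexpand : ∀ a b, softmax w a * softmax w b * (f a - f b) ^ 2 =
      softmax w a * f a ^ 2 * softmax w b + softmax w a * (softmax w b * f b ^ 2) -
        2 * (softmax w a * f a * (softmax w b * f b)) := fun a b => by ring
  simp only [hexpand, Finset.sum_sub_distrib, Finset.sum_add_distrib, ← Finset.mul_sum,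
    ← Finset.sum_mul, sum_softmax, gibbsVar, gibbsMean, Pi.mul_apply, ← sq]
  ring

lemma hasDerivAt_logSumExp_line (w y : A → ℝ) (s : ℝ) :
    HasDerivAt (fun s : ℝ => logSumExp (w + s • y)) (gibbsMean (w + s • y) y) s := by
  refine ((hasDerivAt_sum_exp_line w y s).log (sum_exp_pos _).ne').congr_deriv ?_
  simp only [gibbsMean, softmax, Finset.sum_div, div_mul_eq_mul_div]

lemma hasDerivAt_gibbsMean_line (w f y : A → ℝ) (s : ℝ) :
    HasDerivAt (fun s : ℝ => gibbsMean (w + s • y) f)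
      (gibbsMean (w + s • y) (f * y) - gibbsMean (w + s • y) f * gibbsMean (w + s • y) y) s := by
  have hsoftmax : ∀ a, HasDerivAt (fun s : ℝ => softmax (w + s • y) a)
      (softmax (w + s • y) a * (y a - gibbsMean (w + s • y) y)) s := by
    intro a
    have hexp : HasDerivAt (fun s : ℝ => Real.exp ((w + s • y) a))
        (Real.exp ((w + s • y) a) * y a) s := by
      simpa using (((hasDerivAt_id s).mul_const (y a)).const_add (w a)).exp
    refine (hexp.div (hasDerivAt_sum_exp_line w y s) (sum_exp_pos _).ne').congr_deriv ?_
    have hpos := (sum_exp_pos (w + s • y)).ne'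
    simp only [gibbsMean, softmax, div_mul_eq_mul_div, ← Finset.sum_div]
    field_simp
  refine (HasDerivAt.fun_sum fun a _ => (hsoftmax a).mul_const (f a)).congr_deriv ?_
  simp only [gibbsMean, Pi.mul_apply]
  rw [Finset.sum_mul, ← Finset.sum_sub_distrib]
  exact Finset.sum_congr rfl fun a _ => by ring

lemma abs_sub_taylor_two_le {f f' f'' f''' : ℝ → ℝ} {C : ℝ} (hf : ∀ s, HasDerivAt f (f' s) s)
    (hf' : ∀ s, HasDerivAt f' (f'' s) s) (hf'' : ∀ s, HasDerivAt f'' (f''' s) s)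
    (hC : ∀ s, |f''' s| ≤ C) : |f 1 - f 0 - f' 0 - f'' 0 / 2| ≤ C / 6 := by
  have hstep : ∀ {g g' b b' : ℝ → ℝ}, (∀ s, HasDerivAt g (g' s) s) → (∀ s, HasDerivAt b (b' s) s) →
      g 0 = 0 → b 0 = 0 → (∀ s ∈ Set.Icc (0 : ℝ) 1, |g' s| ≤ b' s) →
      ∀ s ∈ Set.Icc (0 : ℝ) 1, |g s| ≤ b s := by
    intro g g' b b' hg hb hg0 hb0 hle
    exact image_norm_le_of_norm_deriv_right_le_deriv_boundary
      (fun s _ => (hg s).continuousAt.continuousWithinAt) (fun s _ => (hg s).hasDerivWithinAt)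
      (by simp [hg0, hb0]) (fun s => hb s) fun s hs => hle s (Set.Ico_subset_Icc_self hs)
  have hsecond : ∀ s ∈ Set.Icc (0 : ℝ) 1, |f'' s - f'' 0| ≤ C * s :=
    hstep (fun s => (hf'' s).sub_const _) (fun s => (hasDerivAt_id s).const_mul C)
      (sub_self _) (mul_zero C) fun s _ => by simpa using hC s
  have hfirst : ∀ s ∈ Set.Icc (0 : ℝ) 1, |f' s - f' 0 - s * f'' 0| ≤ C * s ^ 2 / 2 :=
    hstep (fun s => ((hf' s).sub_const _).sub ((hasDerivAt_id s).mul_const _))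
      (fun s => (((hasDerivAt_pow 2 s).const_mul C).div_const 2)) (by simp) (by simp)
      fun s hs => by simpa using (hsecond s hs).trans_eq (by ring)
  have hzeroth : ∀ s ∈ Set.Icc (0 : ℝ) 1,
      |f s - f 0 - s * f' 0 - s ^ 2 / 2 * f'' 0| ≤ C * s ^ 3 / 6 :=
    hstep (fun s => (((hf s).sub_const _).sub ((hasDerivAt_id s).mul_const _)).sub
        (((hasDerivAt_pow 2 s).div_const 2).mul_const _))
      (fun s => (((hasDerivAt_pow 3 s).const_mul C).div_const 6)) (by simp) (by simp)
      fun s hs => by simpa using (hfirst s hs).trans_eq (by ring)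
  convert hzeroth 1 (by simp) using 2 <;> ring

lemma abs_logSumExp_add_sub_le (w y : A → ℝ) :
    |logSumExp (w + y) - logSumExp w - gibbsMean w y - gibbsVar w y / 2| ≤ ‖y‖ ^ 3 := by
  set G : ℝ → (A → ℝ) → ℝ := fun s => gibbsMean (w + s • y)
  have hG : ∀ f s, HasDerivAt (G · f) (G s (f * y) - G s f * G s y) s :=
    fun f s => hasDerivAt_gibbsMean_line w f y s
  have hthird : ∀ s, |G s (y * y * y) - G s (y * y) * G s y -
      ((G s (y * y) - G s y * G s y) * G s y + G s y * (G s (y * y) - G s y * G s y))| ≤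
        6 * ‖y‖ ^ 3 := by
    intro s
    have hmean : |G s y| ≤ ‖y‖ := abs_gibbsMean_le _ _
    have hmean_sq : |G s (y * y)| ≤ ‖y‖ ^ 2 := (abs_gibbsMean_le _ _).trans (by
      simpa [sq] using norm_mul_le y y)
    have hmean_cube : |G s (y * y * y)| ≤ ‖y‖ ^ 3 := (abs_gibbsMean_le _ _).trans (by
      calc ‖y * y * y‖ ≤ ‖y‖ * ‖y‖ * ‖y‖ :=
            (norm_mul_le _ _).trans (by gcongr; exact norm_mul_le y y)
        _ = ‖y‖ ^ 3 := by ring)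
    have hprod : |G s (y * y) * G s y| ≤ ‖y‖ ^ 3 := by
      rw [abs_mul, pow_succ]
      gcongr
    have hpow : |G s y ^ 3| ≤ ‖y‖ ^ 3 := by
      rw [abs_pow]
      gcongr
    rw [abs_le] at hmean_cube hprod hpow ⊢
    constructor <;> nlinarith
  have htaylor := abs_sub_taylor_two_le (hasDerivAt_logSumExp_line w y) (hG y)
    (fun s => (hG (y * y) s).sub ((hG y s).mul (hG y s))) hthird
  simpa [G, gibbsVar] using htaylor

end LogSumExp

section Comparison

open scoped NNReal

variable {A : Type*} [Fintype A]

lemma integral_gibbsMean_eq_zero {μ : Measure (A → ℝ)} [IsGaussian μ] (hμ : μ[id] = 0) (w : A → ℝ) :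
    ∫ y, gibbsMean w y ∂μ = 0 := by
  have happly : ∀ a, Integrable (fun y : A → ℝ => softmax w a * y a) μ := fun a =>
    (IsGaussian.integrable_dual μ (ContinuousLinearMap.proj a)).const_mul _
  have hzero : ∀ a, ∫ y : A → ℝ, y a ∂μ = 0 := fun a =>
    (IsGaussian.integral_dual (μ := μ) (ContinuousLinearMap.proj (R := ℝ) a)).trans
      (by rw [show ∫ y, y ∂μ = 0 from hμ, map_zero])
  simp only [gibbsMean]
  rw [integral_finsetSum _ fun a _ => happly a]
  simp only [integral_const_mul, hzero, mul_zero, Finset.sum_const_zero]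

lemma integrable_sq_sub_apply {A : Type*} [Finite A] (μ : Measure (A → ℝ)) [IsGaussian μ]
    (a b : A) : Integrable (fun y : A → ℝ => (y a - y b) ^ 2) μ := by
  cases nonempty_fintype A
  let ℓ : A → StrongDual ℝ (A → ℝ) := ContinuousLinearMap.proj
  simpa [ℓ] using (IsGaussian.memLp_dual μ (ℓ a - ℓ b) 2 (by simp)).integrable_sq

lemma integral_dilate_sq_sub_apply (μ : Measure (A → ℝ)) (s : ℝ≥0) (a b : A) :
    ∫ y, (y a - y b) ^ 2 ∂(dilate μ s) = s * ∫ y, (y a - y b) ^ 2 ∂μ := by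
  rw [integral_dilate s (by fun_prop), ← integral_const_mul]
  congr! 2
  simp only [Pi.smul_apply, smul_eq_mul]
  rw [← mul_sub, mul_pow, Real.sq_sqrt s.coe_nonneg]

variable [Nonempty A]

lemma lipschitzWith_iSup_apply : LipschitzWith 1 fun w : A → ℝ => ⨆ a, w a := by
  refine LipschitzWith.of_le_add fun w w' => ciSup_le fun a => ?_
  have hdist := (le_abs_self _).trans (dist_le_pi_dist w w' a)
  linarith [le_ciSup (Set.finite_range w').bddAbove a]

lemma lipschitzWith_logSumExp : LipschitzWith 1 (logSumExp : (A → ℝ) → ℝ) := by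
  refine LipschitzWith.of_le_add fun w w' => ?_
  rw [logSumExp, Real.log_le_iff_le_exp (sum_exp_pos w), Real.exp_add, logSumExp,
    Real.exp_log (sum_exp_pos w'), Finset.sum_mul]
  refine Finset.sum_le_sum fun a _ => ?_
  rw [← Real.exp_add, Real.exp_le_exp]
  linarith [(le_abs_self _).trans (dist_le_pi_dist w w' a)]

lemma iSup_le_logSumExp (w : A → ℝ) : ⨆ a, w a ≤ logSumExp w := by
  refine ciSup_le fun a => ?_
  rw [logSumExp, Real.le_log_iff_exp_le (sum_exp_pos w)]
  exact Finset.single_le_sum (fun b _ => (Real.exp_pos (w b)).le) (Finset.mem_univ a)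

lemma logSumExp_le_iSup_add_log_card (w : A → ℝ) :
    logSumExp w ≤ (⨆ a, w a) + Real.log (Fintype.card A) := by
  have hcard : (0 : ℝ) < Fintype.card A := by exact_mod_cast Fintype.card_pos
  rw [logSumExp, Real.log_le_iff_le_exp (sum_exp_pos w), Real.exp_add, Real.exp_log hcard, mul_comm,
    ← nsmul_eq_mul, ← Finset.card_univ]
  exact Finset.sum_le_card_nsmul _ _ _ fun a _ =>
    Real.exp_le_exp.2 (le_ciSup (Set.finite_range w).bddAbove a)

section SmallIncrement

variable {μ ν : Measure (A → ℝ)} [IsGaussian μ] [IsGaussian ν]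

lemma integrable_gibbsVar (μ : Measure (A → ℝ)) [IsGaussian μ] (w : A → ℝ) :
    Integrable (gibbsVar w) μ := by
  simp only [funext (gibbsVar_eq_sum_sub_sq w)]
  exact (integrable_finsetSum _ fun a _ => integrable_finsetSum _ fun b _ =>
    (integrable_sq_sub_apply μ a b).const_mul _).const_mul _

lemma integral_gibbsVar_le
    (h : ∀ a b, ∫ y, (y a - y b) ^ 2 ∂μ ≤ ∫ y, (y a - y b) ^ 2 ∂ν) (w : A → ℝ) :
    ∫ y, gibbsVar w y ∂μ ≤ ∫ y, gibbsVar w y ∂ν := by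
  have heq : ∀ (κ : Measure (A → ℝ)) [IsGaussian κ], ∫ y, gibbsVar w y ∂κ =
      2⁻¹ * ∑ a, ∑ b, softmax w a * softmax w b * ∫ y, (y a - y b) ^ 2 ∂κ := by
    intro κ _
    simp only [gibbsVar_eq_sum_sub_sq w]
    rw [integral_const_mul, integral_finsetSum _ fun a _ => integrable_finsetSum _ fun b _ =>
      (integrable_sq_sub_apply κ a b).const_mul _]
    simp only [integral_finsetSum _ fun b _ => (integrable_sq_sub_apply κ _ b).const_mul _,
      integral_const_mul]
  rw [heq μ, heq ν]
  refine mul_le_mul_of_nonneg_left (Finset.sum_le_sum fun a _ => Finset.sum_le_sum fun b _ => ?_)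
    (by norm_num)
  exact mul_le_mul_of_nonneg_left (h a b) (mul_nonneg (softmax_nonneg w a) (softmax_nonneg w b))

lemma abs_integral_logSumExp_add_sub_le (hμ : μ[id] = 0) (w : A → ℝ) :
    |∫ y, logSumExp (w + y) ∂μ - (logSumExp w + (∫ y, gibbsVar w y ∂μ) / 2)| ≤
      ∫ y, ‖y‖ ^ 3 ∂μ := by
  have hlse : Integrable (fun y => logSumExp (w + y)) μ :=
    integrable_of_lipschitzWith μ (L := 1) (by
      simpa [Function.comp_def] using
        lipschitzWith_logSumExp.comp (isometry_add_left w).lipschitz)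
  have hmean : Integrable (gibbsMean w) μ := integrable_finsetSum _ fun a _ =>
    (IsGaussian.integrable_dual μ (ContinuousLinearMap.proj a)).const_mul _
  have hvar := (integrable_gibbsVar μ w).div_const 2
  have hconst : Integrable (fun _ : A → ℝ => logSumExp w) μ := integrable_const _
  calc |∫ y, logSumExp (w + y) ∂μ - (logSumExp w + (∫ y, gibbsVar w y ∂μ) / 2)|
      = |∫ y, (logSumExp (w + y) - logSumExp w - gibbsMean w y - gibbsVar w y / 2) ∂μ| := by
        have hsub : Integrable (fun y => logSumExp (w + y) - logSumExp w) μ := hlse.sub hconst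
        have hsub' : Integrable (fun y => logSumExp (w + y) - logSumExp w - gibbsMean w y) μ :=
          hsub.sub hmean
        rw [integral_sub hsub' hvar, integral_sub hsub hmean, integral_sub hlse hconst,
          integral_gibbsMean_eq_zero hμ, integral_div]
        simp [sub_sub]
    _ ≤ ∫ y, ‖y‖ ^ 3 ∂μ := by
        rw [← Real.norm_eq_abs]
        exact norm_integral_le_of_norm_le (integrable_pow_norm μ 3)
          (ae_of_all _ fun y => abs_logSumExp_add_sub_le w y)

lemma integral_logSumExp_add_le_of_integral_sq_sub_le (hμ : μ[id] = 0) (hν : ν[id] = 0)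
    (h : ∀ a b, ∫ y, (y a - y b) ^ 2 ∂μ ≤ ∫ y, (y a - y b) ^ 2 ∂ν) (w : A → ℝ) :
    ∫ y, logSumExp (w + y) ∂μ ≤
      ∫ y, logSumExp (w + y) ∂ν + (∫ y, ‖y‖ ^ 3 ∂μ + ∫ y, ‖y‖ ^ 3 ∂ν) := by
  have hvar := integral_gibbsVar_le h w
  have hexpandμ := (abs_le.1 (abs_integral_logSumExp_add_sub_le hμ w)).2
  have hexpandν := (abs_le.1 (abs_integral_logSumExp_add_sub_le hν w)).1
  linarith

end SmallIncrement

section Lindeberg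

variable {V : Type*} [NormedAddCommGroup V] [NormedSpace ℝ V] [MeasurableSpace V] [BorelSpace V]
  [SecondCountableTopology V] [CompleteSpace V] {L : ℝ≥0} {f : V → ℝ}

lemma integral_comp_add_conv_le {μ μ' ν ν' : Measure V} [IsGaussian μ] [IsGaussian μ']
    [IsGaussian ν] [IsGaussian ν'] {δ δ' : ℝ} (hf : LipschitzWith L f)
    (h : ∀ w, ∫ x, f (w + x) ∂μ ≤ ∫ x, f (w + x) ∂ν + δ)
    (h' : ∀ w, ∫ x, f (w + x) ∂μ' ≤ ∫ x, f (w + x) ∂ν' + δ') (w : V) :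
    ∫ x, f (w + x) ∂(μ ∗ μ') ≤ ∫ x, f (w + x) ∂(ν ∗ ν') + (δ + δ') := by
  have hshift : ∀ w, LipschitzWith L fun x => f (w + x) := fun w => by
    simpa [Function.comp_def] using hf.comp (isometry_add_left w).lipschitz
  have hint : ∀ (κ κ' : Measure V) [IsGaussian κ] [IsGaussian κ'],
      Integrable (fun x => ∫ z, f (w + x + z) ∂κ') κ := fun κ κ' _ _ =>
    integrable_of_lipschitzWith κ (L := L) <| by
      simpa only [add_assoc] using lipschitzWith_integral_comp_add (hshift w) fun x => by
        simpa only [add_assoc] using integrable_of_lipschitzWith κ' (hshift (w + x))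
  have hconv : ∀ (κ κ' : Measure V) [IsGaussian κ] [IsGaussian κ'],
      ∫ x, f (w + x) ∂(κ ∗ κ') = ∫ x, ∫ z, f (w + x + z) ∂κ' ∂κ := fun κ κ' _ _ => by
    simpa only [add_assoc] using integral_conv (integrable_of_lipschitzWith (κ ∗ κ') (hshift w))
  have hadd : ∀ (κ κ' : Measure V) [IsGaussian κ] [IsGaussian κ'] (ε : ℝ),
      ∫ x, (∫ z, f (w + x + z) ∂κ' + ε) ∂κ = ∫ x, f (w + x) ∂(κ ∗ κ') + ε := fun κ κ' _ _ ε => by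
    rw [integral_add (hint κ κ') (integrable_const ε), hconv]
    simp
  calc ∫ x, f (w + x) ∂(μ ∗ μ') ≤ ∫ x, (∫ z, f (w + x + z) ∂ν' + δ') ∂μ := by
        rw [hconv]
        exact integral_mono (hint μ μ') ((hint μ ν').add (integrable_const _)) fun x => h' (w + x)
    _ = ∫ z, ∫ x, f (w + z + x) ∂μ ∂ν' + δ' := by
        rw [hadd, Measure.conv_comm, hconv]
    _ ≤ ∫ z, (∫ x, f (w + z + x) ∂ν + δ) ∂ν' + δ' := by
        refine add_le_add_left ?_ δ'
        exact integral_mono (hint ν' μ) ((hint ν' ν).add (integrable_const _)) fun z => h (w + z)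
    _ = ∫ x, f (w + x) ∂(ν ∗ ν') + (δ + δ') := by
        rw [hadd, Measure.conv_comm, add_assoc]

lemma integral_comp_add_dilate_nsmul_le {μ ν : Measure V} [IsGaussian μ] [IsGaussian ν] {s : ℝ≥0}
    {δ : ℝ} (hμ : μ[id] = 0) (hν : ν[id] = 0) (hf : LipschitzWith L f)
    (h : ∀ w, ∫ x, f (w + x) ∂(dilate μ s) ≤ ∫ x, f (w + x) ∂(dilate ν s) + δ) (m : ℕ) (w : V) :
    ∫ x, f (w + x) ∂(dilate μ (m • s)) ≤ ∫ x, f (w + x) ∂(dilate ν (m • s)) + m * δ := by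
  induction m generalizing w with
  | zero => simp [dilate_zero]
  | succ m ih =>
    rw [succ_nsmul, ← dilate_conv_dilate hμ, ← dilate_conv_dilate hν]
    exact (integral_comp_add_conv_le hf ih h w).trans_eq (by push_cast; ring)

end Lindeberg

section SudakovFernique

variable {μ ν : Measure (A → ℝ)} [IsGaussian μ] [IsGaussian ν]

lemma integral_dilate_norm_pow_three {V : Type*} [NormedAddCommGroup V] [NormedSpace ℝ V]
    [MeasurableSpace V] [BorelSpace V] [SecondCountableTopology V] (μ : Measure V) (s : ℝ≥0) :
    ∫ y, ‖y‖ ^ 3 ∂(dilate μ s) = s * √(s : ℝ) * ∫ y, ‖y‖ ^ 3 ∂μ := by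
  rw [integral_dilate s (by fun_prop), ← integral_const_mul]
  congr! 2
  rw [norm_smul_of_nonneg (Real.sqrt_nonneg _), mul_pow, pow_succ, Real.sq_sqrt s.coe_nonneg]

lemma integral_logSumExp_le_of_integral_sq_sub_le (hμ : μ[id] = 0) (hν : ν[id] = 0)
    (h : ∀ a b, ∫ y, (y a - y b) ^ 2 ∂μ ≤ ∫ y, (y a - y b) ^ 2 ∂ν) :
    ∫ y, logSumExp y ∂μ ≤ ∫ y, logSumExp y ∂ν := by
  refine le_of_forall_le_add_mul_sqrt_inv (K := ∫ y, ‖y‖ ^ 3 ∂μ + ∫ y, ‖y‖ ^ 3 ∂ν) fun m => ?_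
  set s : ℝ≥0 := (m + 1 : ℝ≥0)⁻¹
  have hs : (m + 1) • s = 1 := by
    rw [nsmul_eq_mul, Nat.cast_succ, mul_inv_cancel₀ (by positivity)]
  have hs' : (m + 1 : ℝ) * s = 1 := by
    simpa [nsmul_eq_mul] using congrArg ((↑) : ℝ≥0 → ℝ) hs
  have hstep := integral_logSumExp_add_le_of_integral_sq_sub_le (integral_id_dilate hμ s)
    (integral_id_dilate hν s) fun a b => by
      simp only [integral_dilate_sq_sub_apply]
      exact mul_le_mul_of_nonneg_left (h a b) s.coe_nonneg
  have hiter := integral_comp_add_dilate_nsmul_le hμ hν lipschitzWith_logSumExp hstep (m + 1) 0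
  simp only [hs, dilate_one, zero_add, integral_dilate_norm_pow_three] at hiter
  refine hiter.trans_eq ?_
  have hcoe : (s : ℝ) = (m + 1 : ℝ)⁻¹ := by simp [s]
  rw [← hcoe, ← mul_add]
  push_cast
  linear_combination √(s : ℝ) * (∫ y, ‖y‖ ^ 3 ∂μ + ∫ y, ‖y‖ ^ 3 ∂ν) * hs'

theorem integral_iSup_le_of_integral_sq_sub_le (hμ : μ[id] = 0) (hν : ν[id] = 0)
    (h : ∀ a b, ∫ y, (y a - y b) ^ 2 ∂μ ≤ ∫ y, (y a - y b) ^ 2 ∂ν) :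
    ∫ y, ⨆ a, y a ∂μ ≤ ∫ y, ⨆ a, y a ∂ν := by
  refine le_of_forall_le_add_mul_sqrt_inv (K := Real.log (Fintype.card A)) fun m => ?_
  set s : ℝ≥0 := m + 1
  have hlse := integral_logSumExp_le_of_integral_sq_sub_le (integral_id_dilate hμ s)
    (integral_id_dilate hν s) fun a b => by
      simp only [integral_dilate_sq_sub_apply]
      exact mul_le_mul_of_nonneg_left (h a b) s.coe_nonneg
  have hsup : ∀ κ : Measure (A → ℝ), ∫ y, ⨆ a, y a ∂(dilate κ s) = √(s : ℝ) * ∫ y, ⨆ a, y a ∂κ := by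
    intro κ
    rw [integral_dilate s lipschitzWith_iSup_apply.continuous, ← integral_const_mul]
    simp only [Pi.smul_apply, smul_eq_mul, Real.mul_iSup_of_nonneg (Real.sqrt_nonneg _)]
  have hint : ∀ (κ : Measure (A → ℝ)) [IsGaussian κ], Integrable (fun y : A → ℝ => ⨆ a, y a) κ :=
    fun κ _ => integrable_of_lipschitzWith κ lipschitzWith_iSup_apply
  have hscaled : √(s : ℝ) * ∫ y, ⨆ a, y a ∂μ ≤
      √(s : ℝ) * ∫ y, ⨆ a, y a ∂ν + Real.log (Fintype.card A) :=
    calc √(s : ℝ) * ∫ y, ⨆ a, y a ∂μ = ∫ y, ⨆ a, y a ∂(dilate μ s) := (hsup μ).symm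
      _ ≤ ∫ y, logSumExp y ∂(dilate μ s) := integral_mono (hint _)
          (integrable_of_lipschitzWith _ lipschitzWith_logSumExp) iSup_le_logSumExp
      _ ≤ ∫ y, logSumExp y ∂(dilate ν s) := hlse
      _ ≤ ∫ y, ((⨆ a, y a) + Real.log (Fintype.card A)) ∂(dilate ν s) :=
          integral_mono (integrable_of_lipschitzWith _ lipschitzWith_logSumExp)
            ((hint _).add (integrable_const _)) logSumExp_le_iSup_add_log_card
      _ = √(s : ℝ) * ∫ y, ⨆ a, y a ∂ν + Real.log (Fintype.card A) := by
          rw [integral_add (hint _) (integrable_const _), hsup]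
          simp
  have hpos : 0 < √(s : ℝ) := Real.sqrt_pos.2 (by positivity)
  have hcoe : (m + 1 : ℝ) = s := by simp [s]
  rw [hcoe, Real.sqrt_inv, ← mul_le_mul_iff_right₀ hpos]
  refine hscaled.trans_eq ?_
  field_simp

end SudakovFernique
end Comparison

section LinearSuprema

open scoped NNReal RealInnerProductSpace

variable {T E E' : Type*} [NormedAddCommGroup E] [InnerProductSpace ℝ E]
  [NormedAddCommGroup E'] [InnerProductSpace ℝ E']

lemma lipschitzWith_of_isLUB_inner {t : T → E} {F : E → ℝ} {c : ℝ≥0} (ht : ∀ a, ‖t a‖ ≤ c)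
    (hF : ∀ x, IsLUB (Set.range fun a => ⟪t a, x⟫) (F x)) : LipschitzWith c F := by
  refine LipschitzWith.of_le_add_mul c fun x y => (hF x).2 ?_
  rintro _ ⟨a, rfl⟩
  calc ⟪t a, x⟫ = ⟪t a, y⟫ + ⟪t a, x - y⟫ := by rw [← inner_add_right, add_sub_cancel]
    _ ≤ F y + c * dist x y := by
        rw [dist_eq_norm]
        exact add_le_add ((hF y).1 ⟨a, rfl⟩)
          ((real_inner_le_norm _ _).trans (by gcongr; exact ht a))

variable [FiniteDimensional ℝ E]

lemma exists_finite_forall_exists_norm_sub_le {t : T → E} {c : ℝ} (ht : ∀ a, ‖t a‖ ≤ c) {ε : ℝ}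
    (hε : 0 < ε) :
    ∃ N : Set T, N.Finite ∧ ∀ a, ∃ b ∈ N, ‖t a - t b‖ ≤ ε := by
  have hbounded : TotallyBounded (Set.range t) :=
    (Metric.isBounded_closedBall.subset (Set.range_subset_iff.2 fun a =>
      mem_closedBall_zero_iff.2 (ht a))).isCompact_closure.totallyBounded.subset subset_closure
  rw [← Set.image_univ] at hbounded
  obtain ⟨N, -, hN, hcover⟩ := Set.exists_subset_image_finite_and.1
    (Metric.finite_approx_of_totallyBounded hbounded ε hε)
  refine ⟨N, hN, fun a => ?_⟩
  obtain ⟨b, hb, hab⟩ : ∃ b ∈ N, dist (t a) (t b) < ε := by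
    simpa using hcover (Set.mem_image_of_mem t (Set.mem_univ a))
  exact ⟨b, hb, by simpa [dist_eq_norm] using hab.le⟩

variable [MeasurableSpace E] [BorelSpace E]

/-- The joint law of the canonical Gaussian variables `⟪t a, x⟫`, `a ∈ T`, with `x` standard
Gaussian. -/
noncomputable def gaussianProcessLaw (t : T → E) : Measure (T → ℝ) :=
  (stdGaussian E).map (ContinuousLinearMap.pi fun a => innerSL ℝ (t a))

lemma integral_inner_sq_stdGaussian (v : E) : ∫ x, ⟪v, x⟫ ^ 2 ∂(stdGaussian E) = ‖v‖ ^ 2 := by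
  rw [← innerSL_apply_norm (𝕜 := ℝ) v, ← variance_dual_stdGaussian,
    ← integral_strongDual_sq integral_id_stdGaussian]
  simp

instance isGaussian_gaussianProcessLaw [Finite T] (t : T → E) :
    IsGaussian (gaussianProcessLaw t) := by
  cases nonempty_fintype T
  exact isGaussian_map _

lemma integral_gaussianProcessLaw [Finite T] (t : T → E) {G : Type*} [NormedAddCommGroup G]
    [NormedSpace ℝ G] {f : (T → ℝ) → G} (hf : Continuous f) :
    ∫ y, f y ∂(gaussianProcessLaw t) = ∫ x, f (fun a => ⟪t a, x⟫) ∂(stdGaussian E) := by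
  cases nonempty_fintype T
  rw [gaussianProcessLaw, integral_map (by fun_prop) hf.aestronglyMeasurable]
  rfl

lemma integral_id_gaussianProcessLaw [Fintype T] (t : T → E) : (gaussianProcessLaw t)[id] = 0 := by
  rw [integral_gaussianProcessLaw t continuous_id]
  have hcomp := (ContinuousLinearMap.pi fun a => innerSL ℝ (t a)).integral_comp_comm
    (IsGaussian.integrable_id (μ := stdGaussian E))
  rw [show ∫ x, id x ∂(stdGaussian E) = 0 from integral_id_stdGaussian, map_zero] at hcomp
  exact hcomp

lemma integral_sq_sub_gaussianProcessLaw [Finite T] (t : T → E) (a b : T) :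
    ∫ y, (y a - y b) ^ 2 ∂(gaussianProcessLaw t) = ‖t a - t b‖ ^ 2 := by
  rw [integral_gaussianProcessLaw t (by fun_prop), ← integral_inner_sq_stdGaussian]
  simp only [inner_sub_left]

variable [FiniteDimensional ℝ E'] [MeasurableSpace E'] [BorelSpace E'] {t : T → E} {s : T → E'}

lemma integral_iSup_inner_le_of_norm_sub_le [Finite T] [Nonempty T]
    (h : ∀ a b, ‖t a - t b‖ ≤ ‖s a - s b‖) :
    ∫ x, ⨆ a, ⟪t a, x⟫ ∂(stdGaussian E) ≤ ∫ y, ⨆ a, ⟪s a, y⟫ ∂(stdGaussian E') := by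
  cases nonempty_fintype T
  rw [← integral_gaussianProcessLaw t lipschitzWith_iSup_apply.continuous,
    ← integral_gaussianProcessLaw s lipschitzWith_iSup_apply.continuous]
  refine integral_iSup_le_of_integral_sq_sub_le (integral_id_gaussianProcessLaw t)
    (integral_id_gaussianProcessLaw s) fun a b => ?_
  rw [integral_sq_sub_gaussianProcessLaw, integral_sq_sub_gaussianProcessLaw]
  gcongr
  exact h a b

lemma integrable_iSup_inner [Finite T] [Nonempty T] (t : T → E) :
    Integrable (fun x => ⨆ a, ⟪t a, x⟫) (stdGaussian E) := by
  cases nonempty_fintype T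
  refine integrable_of_lipschitzWith _ (lipschitzWith_iSup_apply.comp
    (ContinuousLinearMap.pi fun a => innerSL ℝ (t a)).lipschitz)

theorem integral_le_of_isLUB_inner {F : E → ℝ} {H : E' → ℝ} {c : ℝ≥0} (ht : ∀ a, ‖t a‖ ≤ c)
    (h : ∀ a b, ‖t a - t b‖ ≤ ‖s a - s b‖) (hF : ∀ x, IsLUB (Set.range fun a => ⟪t a, x⟫) (F x))
    (hH : ∀ a y, ⟪s a, y⟫ ≤ H y) (hHint : Integrable H (stdGaussian E')) :
    ∫ x, F x ∂(stdGaussian E) ≤ ∫ y, H y ∂(stdGaussian E') := by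
  refine le_of_forall_pos_le_add fun δ hδ => ?_
  set M := ∫ x : E, ‖x‖ ∂(stdGaussian E)
  have hM : 0 ≤ M := integral_nonneg fun x => norm_nonneg x
  obtain ⟨N, hN, hnet⟩ :=
    exists_finite_forall_exists_norm_sub_le ht (ε := δ / (M + 1)) (by positivity)
  have hNfin := hN.to_subtype
  obtain ⟨_, a₀, -⟩ := (hF 0).nonempty
  have hNne : Nonempty N := let ⟨b, hb, _⟩ := hnet a₀; ⟨⟨b, hb⟩⟩
  have happrox : ∀ x, F x ≤ (⨆ b : N, ⟪t b, x⟫) + δ / (M + 1) * ‖x‖ := by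
    refine fun x => (hF x).2 ?_
    rintro _ ⟨a, rfl⟩
    obtain ⟨b, hb, hab⟩ := hnet a
    calc ⟪t a, x⟫ = ⟪t b, x⟫ + ⟪t a - t b, x⟫ := by rw [← inner_add_left, add_sub_cancel]
      _ ≤ (⨆ b : N, ⟪t b, x⟫) + δ / (M + 1) * ‖x‖ :=
          add_le_add (le_ciSup (f := fun b : N => ⟪t b, x⟫) (Set.finite_range _).bddAbove ⟨b, hb⟩)
            ((real_inner_le_norm _ _).trans (by gcongr))
  have hnorm : Integrable (fun x : E => δ / (M + 1) * ‖x‖) (stdGaussian E) :=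
    (integrable_of_lipschitzWith _ lipschitzWith_one_norm).const_mul _
  have hsup := integrable_iSup_inner fun b : N => t b
  calc ∫ x, F x ∂(stdGaussian E)
      ≤ ∫ x, ((⨆ b : N, ⟪t b, x⟫) + δ / (M + 1) * ‖x‖) ∂(stdGaussian E) :=
        integral_mono (integrable_of_lipschitzWith _ (lipschitzWith_of_isLUB_inner ht hF))
          (hsup.add hnorm) happrox
    _ = ∫ x, ⨆ b : N, ⟪t b, x⟫ ∂(stdGaussian E) + δ / (M + 1) * M := by
        rw [integral_add hsup hnorm, integral_const_mul]
    _ ≤ ∫ y, ⨆ b : N, ⟪s b, y⟫ ∂(stdGaussian E') + δ := by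
        gcongr
        · exact integral_iSup_inner_le_of_norm_sub_le fun a b => h a b
        · rw [div_mul_eq_mul_div, div_le_iff₀ (by positivity)]
          linarith only [hδ, mul_add_one δ M]
    _ ≤ ∫ y, H y ∂(stdGaussian E') + δ := by
        gcongr
        · exact integrable_iSup_inner fun b : N => s b
        · exact fun y => ciSup_le fun b => hH b y

end LinearSuprema

section OperatorNorm

open scoped RealInnerProductSpace

variable {E F : Type*} [NormedAddCommGroup E] [InnerProductSpace ℝ E] [NormedAddCommGroup F]
  [InnerProductSpace ℝ F]

/-- The unit vectors of a normed space, as a type. -/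
abbrev UnitSphere (E : Type*) [NormedAddCommGroup E] : Type _ := Metric.sphere (0 : E) 1

lemma isLUB_inner_opNorm [Nontrivial E] [Nontrivial F] (A : E →L[ℝ] F) :
    IsLUB (Set.range fun z : UnitSphere F × UnitSphere E => ⟪(z.1 : F), A z.2⟫) ‖A‖ := by
  refine ⟨?_, fun c hc => ?_⟩
  · rintro _ ⟨⟨u, v⟩, rfl⟩
    calc ⟪(u : F), A v⟫ ≤ ‖(u : F)‖ * ‖A v‖ := real_inner_le_norm _ _
      _ ≤ ‖A‖ := by simpa using A.le_opNorm v
  · have hle : ∀ (u : F) (v : E), ‖u‖ = 1 → ‖v‖ = 1 → ⟪u, A v⟫ ≤ c := fun u v hu hv =>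
      hc ⟨(⟨u, by simpa using hu⟩, ⟨v, by simpa using hv⟩), rfl⟩
    obtain ⟨u₀, hu₀⟩ := exists_norm_eq F zero_le_one
    obtain ⟨v₀, hv₀⟩ := exists_norm_eq E zero_le_one
    have hneg := hle (-u₀) v₀ (by rwa [norm_neg]) hv₀
    rw [inner_neg_left] at hneg
    have hc₀ : 0 ≤ c := by linarith [hle u₀ v₀ hu₀ hv₀]
    refine A.opNorm_le_of_unit_norm hc₀ fun v hv => ?_
    rcases eq_or_ne (A v) 0 with hAv | hAv
    · rwa [hAv, norm_zero]
    · have hunit := hle (‖A v‖⁻¹ • A v) v (norm_smul_inv_norm hAv) hv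
      rwa [real_inner_smul_left, real_inner_self_eq_norm_mul_norm,
        inv_mul_cancel_left₀ (norm_ne_zero_iff.2 hAv)] at hunit

lemma integral_norm_sq_apply_stdGaussian_le [FiniteDimensional ℝ E] [MeasurableSpace E]
    [BorelSpace E] [FiniteDimensional ℝ F] (A : E →L[ℝ] F) :
    ∫ x, ‖A x‖ ^ 2 ∂(stdGaussian E) ≤ ‖A‖ ^ 2 * Module.finrank ℝ F := by
  have : CompleteSpace E := FiniteDimensional.complete ℝ E
  have : CompleteSpace F := FiniteDimensional.complete ℝ F
  set b := stdOrthonormalBasis ℝ F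
  have hnorm : ∀ x, ‖A x‖ ^ 2 = ∑ i, ⟪A.adjoint (b i), x⟫ ^ 2 := fun x => by
    rw [← b.sum_sq_inner_right]
    simp only [ContinuousLinearMap.adjoint_inner_left]
  have hint : ∀ i, Integrable (fun x => ⟪A.adjoint (b i), x⟫ ^ 2) (stdGaussian E) := fun i =>
    (IsGaussian.memLp_dual (stdGaussian E) (innerSL ℝ (A.adjoint (b i))) 2
      (by norm_num)).integrable_sq
  simp only [hnorm]
  rw [integral_finsetSum _ fun i _ => hint i]
  calc ∑ i, ∫ x, ⟪A.adjoint (b i), x⟫ ^ 2 ∂(stdGaussian E)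
      = ∑ i, ‖A.adjoint (b i)‖ ^ 2 := by simp only [integral_inner_sq_stdGaussian]
    _ ≤ ∑ _i : Fin (Module.finrank ℝ F), ‖A‖ ^ 2 := by
        gcongr with i
        simpa [b.norm_eq_one] using A.adjoint.le_opNorm (b i)
    _ = ‖A‖ ^ 2 * Module.finrank ℝ F := by simp [mul_comm]

lemma integral_norm_apply_stdGaussian_le [FiniteDimensional ℝ E] [MeasurableSpace E]
    [BorelSpace E] [FiniteDimensional ℝ F] (A : E →L[ℝ] F) :
    ∫ x, ‖A x‖ ∂(stdGaussian E) ≤ ‖A‖ * √(Module.finrank ℝ F) := by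
  have hmem : MemLp (fun x => ‖A x‖) 2 (stdGaussian E) :=
    (A.comp_memLp' (IsGaussian.memLp_two_id (μ := stdGaussian E))).norm
  have hvar := variance_nonneg (fun x => ‖A x‖) (stdGaussian E)
  rw [variance_eq_sub hmem, sub_nonneg] at hvar
  refine (Real.le_sqrt_of_sq_le (hvar.trans (integral_norm_sq_apply_stdGaussian_le A))).trans_eq ?_
  rw [Real.sqrt_mul (sq_nonneg _), Real.sqrt_sq (norm_nonneg _)]

lemma opNorm_nonneg {m p : ℕ} (A : Matrix (Fin m) (Fin p) ℝ) : 0 ≤ opNorm A := norm_nonneg _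

open scoped Matrix.Norms.L2Operator in
lemma opNorm_transpose {m p : ℕ} (A : Matrix (Fin m) (Fin p) ℝ) :
    opNorm A.transpose = opNorm A := by
  rw [← Matrix.conjTranspose_eq_transpose_of_trivial]
  exact Matrix.l2_opNorm_conjTranspose A

lemma sum_sq_col_le_opNorm_sq {m p : ℕ} (A : Matrix (Fin m) (Fin p) ℝ) (b : Fin p) :
    ∑ a, A a b ^ 2 ≤ opNorm A ^ 2 := by
  have hcol : ∑ a, A a b ^ 2 = ‖Matrix.toEuclideanLin A (EuclideanSpace.single b 1)‖ ^ 2 := by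
    simp [EuclideanSpace.real_norm_sq_eq, Matrix.toLpLin_apply]
  rw [hcol]
  gcongr
  simpa [opNorm] using
    (Matrix.toEuclideanLin A).toContinuousLinearMap.le_opNorm (EuclideanSpace.single b 1)

lemma sum_sq_row_le_opNorm_sq {m p : ℕ} (A : Matrix (Fin m) (Fin p) ℝ) (a : Fin m) :
    ∑ b, A a b ^ 2 ≤ opNorm A ^ 2 := by
  rw [← opNorm_transpose]
  exact sum_sq_col_le_opNorm_sq A.transpose a

end OperatorNorm

section Symmetrization

open scoped RealInnerProductSpace

variable {k n : ℕ}

/-- Tensors of order `k` on `ℝⁿ` as a Euclidean space, with the Frobenius inner product. -/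
abbrev TensorSpace (k n : ℕ) : Type := EuclideanSpace ℝ (Fin k → Fin n)

lemma symNoise_apply (X : Tensor k n) (i : Fin k → Fin n) :
    symNoise X i = 1 / (k ! : ℝ) * √((k : ℝ) / (n : ℝ)) * ∑ π : Equiv.Perm (Fin k), X (i ∘ π) := by
  simp [symNoise, permute, Function.comp_def]

/-- The symmetrization `symNoise` as a linear endomorphism of the Euclidean space of tensors. -/
noncomputable def symNoiseLin : TensorSpace k n →ₗ[ℝ] TensorSpace k n where
  toFun X := WithLp.toLp 2 (symNoise X.ofLp)
  map_add' X Y := by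
    ext i
    simp [symNoise_apply, Finset.sum_add_distrib, mul_add]
  map_smul' c X := by
    ext i
    simp only [symNoise_apply, PiLp.smul_apply, smul_eq_mul, ← Finset.mul_sum, WithLp.ofLp_smul,
      Pi.smul_apply, RingHom.id_apply]
    ring

lemma symNoiseLin_apply (X : TensorSpace k n) (i : Fin k → Fin n) :
    symNoiseLin X i = symNoise X.ofLp i := rfl

lemma sum_comp_perm {M : Type*} [AddCommMonoid M] (π : Equiv.Perm (Fin k))
    (f : (Fin k → Fin n) → M) : ∑ i, f (i ∘ π) = ∑ i, f i :=
  Equiv.sum_comp (Equiv.arrowCongr π.symm (Equiv.refl (Fin n))) f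

lemma inner_symNoiseLin_left (X Y : TensorSpace k n) :
    ⟪symNoiseLin X, Y⟫ = ⟪X, symNoiseLin Y⟫ := by
  simp only [PiLp.inner_apply, symNoiseLin_apply, symNoise_apply, RCLike.inner_apply, conj_trivial,
    Finset.mul_sum, Finset.sum_mul]
  rw [Finset.sum_comm, Finset.sum_comm (γ := Fin k → Fin n)]
  refine Fintype.sum_equiv (Equiv.inv _) _ _ fun π => ?_
  rw [← sum_comp_perm π⁻¹]
  refine Finset.sum_congr rfl fun i _ => ?_
  have hcancel : (i ∘ ⇑π⁻¹) ∘ ⇑π = i := by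
    ext j
    simp
  rw [hcancel]
  simp only [Equiv.inv_apply]
  ring

lemma norm_toLp_permute (π : Equiv.Perm (Fin k)) (X : TensorSpace k n) :
    ‖(WithLp.toLp 2 (permute π X.ofLp) : TensorSpace k n)‖ = ‖X‖ := by
  rw [EuclideanSpace.norm_eq, EuclideanSpace.norm_eq]
  congr 1
  exact sum_comp_perm π fun i => ‖X i‖ ^ 2

lemma norm_symNoiseLin_le (X : TensorSpace k n) :
    ‖symNoiseLin X‖ ≤ √((k : ℝ) / (n : ℝ)) * ‖X‖ := by
  have hsum : symNoiseLin X = (1 / (k ! : ℝ) * √((k : ℝ) / (n : ℝ))) •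
      ∑ π : Equiv.Perm (Fin k), (WithLp.toLp 2 (permute π X.ofLp) : TensorSpace k n) := by
    ext i
    simp [symNoiseLin_apply, symNoise]
  rw [hsum, norm_smul, Real.norm_of_nonneg (by positivity)]
  calc 1 / (k ! : ℝ) * √((k : ℝ) / (n : ℝ)) *
        ‖∑ π : Equiv.Perm (Fin k), (WithLp.toLp 2 (permute π X.ofLp) : TensorSpace k n)‖
      ≤ 1 / (k ! : ℝ) * √((k : ℝ) / (n : ℝ)) * ∑ _π : Equiv.Perm (Fin k), ‖X‖ := by
        gcongr
        exact (norm_sum_le _ _).trans_eq (by simp only [norm_toLp_permute])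
    _ = √((k : ℝ) / (n : ℝ)) * ‖X‖ := by
        rw [Finset.sum_const, Finset.card_univ, Fintype.card_perm, Fintype.card_fin, nsmul_eq_mul]
        field_simp

lemma symNoise_eq_inner (X : TensorSpace k n) (i : Fin k → Fin n) :
    symNoise X.ofLp i = ⟪symNoiseLin (EuclideanSpace.single i 1), X⟫ := by
  rw [inner_symNoiseLin_left, EuclideanSpace.inner_single_left]
  simp [symNoiseLin_apply]

lemma sum_card_comp_perm_eq (i : Fin k → Fin n) :
    ∑ j : Fin k → Fin n, Fintype.card {π : Equiv.Perm (Fin k) // j ∘ π = i} = k ! := by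
  simp only [Fintype.card_subtype, Finset.card_filter]
  rw [Finset.sum_comm]
  simp only [sum_comp_perm _ fun j => if j = i then 1 else 0]
  simp [Fintype.card_perm]

lemma le_norm_sq_symNoiseLin_single (i : Fin k → Fin n) :
    (k : ℝ) / n / k ! ≤ ‖symNoiseLin (EuclideanSpace.single i (1 : ℝ))‖ ^ 2 := by
  set N : (Fin k → Fin n) → ℕ := fun j => Fintype.card {π : Equiv.Perm (Fin k) // j ∘ π = i}
  have hentry : ∀ j, symNoiseLin (EuclideanSpace.single i (1 : ℝ)) j =
      1 / (k ! : ℝ) * √((k : ℝ) / n) * N j := fun j => by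
    simp [symNoiseLin_apply, symNoise_apply, N, Pi.single_apply, Fintype.card_subtype]
  -- The counts `N j` are natural numbers, so `N j ≤ N j ^ 2`.
  have hcount : (k ! : ℝ) ≤ ∑ j, (N j : ℝ) ^ 2 := by
    rw [← sum_card_comp_perm_eq i]
    push_cast
    gcongr with j
    exact_mod_cast Nat.le_self_pow two_ne_zero (N j)
  calc (k : ℝ) / n / k ! = (1 / (k ! : ℝ)) ^ 2 * (k / n) * k ! := by field_simp
    _ ≤ (1 / (k ! : ℝ)) ^ 2 * (k / n) * ∑ j, (N j : ℝ) ^ 2 := by gcongr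
    _ = ‖symNoiseLin (EuclideanSpace.single i (1 : ℝ))‖ ^ 2 := by
        rw [EuclideanSpace.real_norm_sq_eq]
        simp only [hentry, mul_pow, ← Finset.mul_sum]
        rw [Real.sq_sqrt (by positivity)]

lemma integrable_symNoise_sq (i : Fin k → Fin n) :
    Integrable (fun X : TensorSpace k n => symNoise X.ofLp i ^ 2)
      (stdGaussian (TensorSpace k n)) := by
  simp only [symNoise_eq_inner]
  exact (IsGaussian.memLp_dual (stdGaussian (TensorSpace k n))
    (innerSL ℝ (symNoiseLin (EuclideanSpace.single i 1))) 2 (by norm_num)).integrable_sq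

lemma le_integral_symNoise_sq (i : Fin k → Fin n) :
    (k : ℝ) / n / k ! ≤ ∫ X, symNoise X.ofLp i ^ 2 ∂(stdGaussian (TensorSpace k n)) := by
  simp only [symNoise_eq_inner]
  rw [integral_inner_sq_stdGaussian]
  exact le_norm_sq_symNoiseLin_single i

end Symmetrization

section RankOne

open scoped RealInnerProductSpace

variable {k n q : ℕ}

/-- The tensor index whose row and column indices in the unfolding are `a` and `b`. -/
def unfoldIndex (a : Fin (n ^ q)) (b : Fin (n ^ (k - q))) (j : Fin k) : Fin n :=
  if h : (j : ℕ) < q then finFunctionFinEquiv.symm a ⟨j, h⟩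
  else finFunctionFinEquiv.symm b ⟨j - q, by omega⟩

lemma unfolding_apply (X : Tensor k n) (a : Fin (n ^ q)) (b : Fin (n ^ (k - q))) :
    unfolding q X a b = X (unfoldIndex a b) := rfl

/-- The bijection between pairs of row and column indices of the unfolding and tensor indices. -/
def unfoldEquiv (hq : q ≤ k) : (Fin (n ^ q) × Fin (n ^ (k - q))) ≃ (Fin k → Fin n) where
  toFun p := unfoldIndex p.1 p.2
  invFun i := (finFunctionFinEquiv fun j => i ⟨j, by omega⟩,
    finFunctionFinEquiv fun j => i ⟨q + j, by omega⟩)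
  left_inv p := by
    ext1 <;> rw [← Equiv.eq_symm_apply] <;> ext j <;> simp [unfoldIndex]
  right_inv i := by
    ext j
    by_cases h : (j : ℕ) < q
    · simp [unfoldIndex, h]
    · simp only [unfoldIndex, h, dif_neg, not_false_eq_true, Equiv.symm_apply_apply]
      congr 3
      omega

/-- The tensor whose unfolding is the rank one matrix `u vᵀ`. -/
noncomputable def rankOne (hq : q ≤ k) (u : EuclideanSpace ℝ (Fin (n ^ q)))
    (v : EuclideanSpace ℝ (Fin (n ^ (k - q)))) : TensorSpace k n :=
  WithLp.toLp 2 fun i => u ((unfoldEquiv hq).symm i).1 * v ((unfoldEquiv hq).symm i).2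

variable (hq : q ≤ k) (u u' : EuclideanSpace ℝ (Fin (n ^ q)))
  (v v' : EuclideanSpace ℝ (Fin (n ^ (k - q))))

lemma inner_rankOne_left (X : TensorSpace k n) :
    ⟪rankOne hq u v, X⟫ = ⟪u, Matrix.toEuclideanLin (unfolding q X.ofLp) v⟫ := by
  simp only [PiLp.inner_apply, rankOne, RCLike.inner_apply, conj_trivial,
    Matrix.toLpLin_apply, Matrix.mulVec, dotProduct, Finset.sum_mul]
  rw [← (unfoldEquiv hq).sum_comp, Fintype.sum_prod_type]
  refine Finset.sum_congr rfl fun a _ => Finset.sum_congr rfl fun b _ => ?_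
  rw [Equiv.symm_apply_apply, unfolding_apply]
  simp only [unfoldEquiv, Equiv.coe_fn_mk]
  ring

lemma inner_rankOne_rankOne :
    ⟪rankOne hq u v, rankOne hq u' v'⟫ = ⟪u, u'⟫ * ⟪v, v'⟫ := by
  simp only [PiLp.inner_apply, rankOne, RCLike.inner_apply, conj_trivial]
  rw [← (unfoldEquiv hq).sum_comp, Fintype.sum_prod_type, Finset.sum_mul_sum]
  refine Finset.sum_congr rfl fun a _ => Finset.sum_congr rfl fun b _ => ?_
  rw [Equiv.symm_apply_apply]
  ring

lemma norm_rankOne : ‖rankOne hq u v‖ = ‖u‖ * ‖v‖ := by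
  rw [← sq_eq_sq₀ (norm_nonneg _) (by positivity), mul_pow]
  simp only [← real_inner_self_eq_norm_sq, inner_rankOne_rankOne]

variable {u u' v v'}

lemma norm_sq_rankOne_sub_rankOne_le (hu : ‖u‖ = 1) (hu' : ‖u'‖ = 1) (hv : ‖v‖ = 1)
    (hv' : ‖v'‖ = 1) :
    ‖rankOne hq u v - rankOne hq u' v'‖ ^ 2 ≤ ‖u - u'‖ ^ 2 + ‖v - v'‖ ^ 2 := by
  -- The difference of the two sides is `2 (1 - ⟪u, u'⟫) (1 - ⟪v, v'⟫)`.
  rw [norm_sub_sq_real, norm_sub_sq_real, norm_sub_sq_real, inner_rankOne_rankOne, norm_rankOne,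
    norm_rankOne, hu, hu', hv, hv']
  have hinner_u : ⟪u, u'⟫ ≤ 1 := by simpa [hu, hu'] using real_inner_le_norm u u'
  have hinner_v : ⟪v, v'⟫ ≤ 1 := by simpa [hv, hv'] using real_inner_le_norm v v'
  nlinarith

end RankOne

section NoiseNorm

open scoped RealInnerProductSpace

variable {k n q : ℕ}

/-- The tensor representing the linear form `G ↦ ⟪u, Mat_q(Z) v⟫`, where `z = (u, v)` and `Z` is
the symmetric noise tensor built from `G`. -/
noncomputable def noiseForm (hq : q ≤ k) (z : UnitSphere (EuclideanSpace ℝ (Fin (n ^ q))) ×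
    UnitSphere (EuclideanSpace ℝ (Fin (n ^ (k - q))))) : TensorSpace k n :=
  symNoiseLin (rankOne hq z.1.1 z.2.1)

lemma isLUB_inner_noiseForm [NeZero n] (hq : q ≤ k) (X : TensorSpace k n) :
    IsLUB (Set.range fun z => ⟪noiseForm hq z, X⟫) (noiseNorm q X.ofLp) := by
  have hlub := isLUB_inner_opNorm
    (Matrix.toEuclideanLin (unfolding q (symNoiseLin X).ofLp)).toContinuousLinearMap
  simp only [LinearMap.coe_toContinuousLinearMap', ← inner_rankOne_left hq,
    ← inner_symNoiseLin_left] at hlub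
  exact hlub

lemma norm_noiseForm_le (hq : q ≤ k) (z : UnitSphere (EuclideanSpace ℝ (Fin (n ^ q))) ×
    UnitSphere (EuclideanSpace ℝ (Fin (n ^ (k - q))))) :
    ‖noiseForm hq z‖ ≤ NNReal.sqrt (k / n) := by
  simpa [noiseForm, norm_rankOne] using norm_symNoiseLin_le (rankOne hq z.1.1 z.2.1)

lemma norm_noiseForm_sub_le (hq : q ≤ k)
    (z z' : UnitSphere (EuclideanSpace ℝ (Fin (n ^ q))) ×
      UnitSphere (EuclideanSpace ℝ (Fin (n ^ (k - q))))) :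
    ‖noiseForm hq z - noiseForm hq z'‖ ≤ ‖√((k : ℝ) / n) • WithLp.toLp 2 (z.1.1, z.2.1) -
      √((k : ℝ) / n) • WithLp.toLp 2 (z'.1.1, z'.2.1)‖ := by
  rw [noiseForm, noiseForm, ← map_sub, ← smul_sub, norm_smul,
    Real.norm_of_nonneg (Real.sqrt_nonneg _)]
  refine (norm_symNoiseLin_le _).trans ?_
  gcongr
  rw [← sq_le_sq₀ (norm_nonneg _) (norm_nonneg _), WithLp.prod_norm_sq_eq_of_L2]
  exact norm_sq_rankOne_sub_rankOne_le hq (norm_eq_of_mem_sphere _) (norm_eq_of_mem_sphere _)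
    (norm_eq_of_mem_sphere _) (norm_eq_of_mem_sphere _)

lemma lipschitzWith_noiseNorm [NeZero n] (hq : q ≤ k) :
    LipschitzWith (NNReal.sqrt (k / n)) fun X : TensorSpace k n => noiseNorm q X.ofLp :=
  lipschitzWith_of_isLUB_inner (norm_noiseForm_le hq) (isLUB_inner_noiseForm hq)

lemma integrable_noiseNorm [NeZero n] (hq : q ≤ k) :
    Integrable (fun X : TensorSpace k n => noiseNorm q X.ofLp) (stdGaussian (TensorSpace k n)) :=
  integrable_of_lipschitzWith _ (lipschitzWith_noiseNorm hq)

lemma hasSubgaussianMGF_noiseNorm [NeZero n] (hq : q ≤ k) :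
    HasSubgaussianMGF (fun X : TensorSpace k n => noiseNorm q X.ofLp -
        ∫ Y, noiseNorm q Y.ofLp ∂(stdGaussian (TensorSpace k n)))
      (k / n) (stdGaussian (TensorSpace k n)) := by
  rw [← NNReal.sq_sqrt (k / n : NNReal)]
  exact hasSubgaussianMGF_of_lipschitzWith (lipschitzWith_noiseNorm hq) integral_id_stdGaussian
    fun ℓ => (variance_dual_stdGaussian ℓ).le

end NoiseNorm

section UpperBound

open scoped RealInnerProductSpace

variable (E F : Type*) [NormedAddCommGroup E] [InnerProductSpace ℝ E] [FiniteDimensional ℝ E]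
  [MeasurableSpace E] [BorelSpace E] [NormedAddCommGroup F] [InnerProductSpace ℝ F]
  [FiniteDimensional ℝ F] [MeasurableSpace F] [BorelSpace F]

lemma integral_norm_fst_stdGaussian_le :
    ∫ y : WithLp 2 (E × F), ‖y.fst‖ ∂(stdGaussian (WithLp 2 (E × F))) ≤
      √(Module.finrank ℝ E) := by
  have hnorm : ‖WithLp.fstL 2 ℝ E F‖ ≤ 1 :=
    ContinuousLinearMap.opNorm_le_bound _ zero_le_one fun y => by
      simpa using WithLp.norm_fst_le E y
  exact (integral_norm_apply_stdGaussian_le (WithLp.fstL 2 ℝ E F)).trans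
    (mul_le_of_le_one_left (Real.sqrt_nonneg _) hnorm)

lemma integral_norm_snd_stdGaussian_le :
    ∫ y : WithLp 2 (E × F), ‖y.snd‖ ∂(stdGaussian (WithLp 2 (E × F))) ≤
      √(Module.finrank ℝ F) := by
  have hnorm : ‖WithLp.sndL 2 ℝ E F‖ ≤ 1 :=
    ContinuousLinearMap.opNorm_le_bound _ zero_le_one fun y => by
      simpa using WithLp.norm_snd_le E y
  exact (integral_norm_apply_stdGaussian_le (WithLp.sndL 2 ℝ E F)).trans
    (mul_le_of_le_one_left (Real.sqrt_nonneg _) hnorm)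

variable {k n q : ℕ}

/- Sudakov–Fernique: the rank one tensor `u ⊗ v` is compared with the pair `(u, v)`, whose
canonical process `⟪u, g⟫ + ⟪v, h⟫` has supremum `‖g‖ + ‖h‖` over the unit vectors. -/
theorem integral_noiseNorm_le [NeZero n] (hq : q ≤ k) :
    ∫ X, noiseNorm q X.ofLp ∂(stdGaussian (TensorSpace k n)) ≤
      √((k : ℝ) / n) * (√((n : ℝ) ^ q) + √((n : ℝ) ^ (k - q))) := by
  set γ := stdGaussian (WithLp 2 (EuclideanSpace ℝ (Fin (n ^ q)) ×
    EuclideanSpace ℝ (Fin (n ^ (k - q)))))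
  have hfst : Integrable (fun y => ‖y.fst‖) γ :=
    ((WithLp.fstL 2 ℝ _ _).integrable_comp (IsGaussian.integrable_id (μ := γ))).norm
  have hsnd : Integrable (fun y => ‖y.snd‖) γ :=
    ((WithLp.sndL 2 ℝ _ _).integrable_comp (IsGaussian.integrable_id (μ := γ))).norm
  calc ∫ X, noiseNorm q X.ofLp ∂(stdGaussian (TensorSpace k n))
      ≤ ∫ y, √((k : ℝ) / n) * (‖y.fst‖ + ‖y.snd‖) ∂γ := by
        refine integral_le_of_isLUB_inner (norm_noiseForm_le hq)
          (norm_noiseForm_sub_le hq) (isLUB_inner_noiseForm hq) (fun z y => ?_)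
          ((hfst.add hsnd).const_mul _)
        rw [real_inner_smul_left, WithLp.prod_inner_apply]
        gcongr
        · simpa using real_inner_le_norm z.1.1 y.fst
        · simpa using real_inner_le_norm z.2.1 y.snd
    _ = √((k : ℝ) / n) * (∫ y, ‖y.fst‖ ∂γ + ∫ y, ‖y.snd‖ ∂γ) := by
        rw [integral_const_mul, integral_add hfst hsnd]
    _ ≤ √((k : ℝ) / n) * (√((n : ℝ) ^ q) + √((n : ℝ) ^ (k - q))) := by
        gcongr
        · simpa using integral_norm_fst_stdGaussian_le (EuclideanSpace ℝ (Fin (n ^ q)))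
            (EuclideanSpace ℝ (Fin (n ^ (k - q))))
        · simpa using integral_norm_snd_stdGaussian_le (EuclideanSpace ℝ (Fin (n ^ q)))
            (EuclideanSpace ℝ (Fin (n ^ (k - q))))

end UpperBound

section LowerBound

variable {k n q : ℕ}

lemma memLp_noiseNorm [NeZero n] (hq : q ≤ k) :
    MemLp (fun X : TensorSpace k n => noiseNorm q X.ofLp) 2 (stdGaussian (TensorSpace k n)) := by
  have hmem := ((hasSubgaussianMGF_noiseNorm (n := n) hq).memLp 2).add
    (memLp_const (∫ X, noiseNorm q X.ofLp ∂(stdGaussian (TensorSpace k n))))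
  simpa only [Pi.add_def, sub_add_cancel, ENNReal.coe_ofNat] using hmem

lemma integral_noiseNorm_sq_le [NeZero n] (hq : q ≤ k) :
    ∫ X, noiseNorm q X.ofLp ^ 2 ∂(stdGaussian (TensorSpace k n)) ≤
      (∫ X, noiseNorm q X.ofLp ∂(stdGaussian (TensorSpace k n))) ^ 2 + k / n := by
  have hsub := hasSubgaussianMGF_noiseNorm (n := n) hq
  have hmem := memLp_noiseNorm (n := n) hq
  have hvar := integral_sq_le_of_hasSubgaussianMGF hsub
  rw [← variance_eq_integral hmem.aemeasurable, variance_eq_sub hmem] at hvar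
  simp only [Pi.pow_apply, NNReal.coe_div, NNReal.coe_natCast] at hvar
  linarith

lemma card_mul_le_integral_noiseNorm_sq [NeZero n] (hq : q ≤ k) {ι : Type*} [Fintype ι]
    (e : ι → Fin k → Fin n)
    (he : ∀ X : Tensor k n, ∑ a, symNoise X (e a) ^ 2 ≤ noiseNorm q X ^ 2) :
    Fintype.card ι * ((k : ℝ) / n / k !) ≤
      ∫ X, noiseNorm q X.ofLp ^ 2 ∂(stdGaussian (TensorSpace k n)) := by
  calc Fintype.card ι * ((k : ℝ) / n / k !) = ∑ _a : ι, (k : ℝ) / n / k ! := by simp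
    _ ≤ ∑ a, ∫ X, symNoise X.ofLp (e a) ^ 2 ∂(stdGaussian (TensorSpace k n)) := by
        gcongr with a
        exact le_integral_symNoise_sq (e a)
    _ = ∫ X, ∑ a, symNoise X.ofLp (e a) ^ 2 ∂(stdGaussian (TensorSpace k n)) :=
        (integral_finsetSum _ fun a _ => integrable_symNoise_sq _).symm
    _ ≤ ∫ X, noiseNorm q X.ofLp ^ 2 ∂(stdGaussian (TensorSpace k n)) :=
        integral_mono (integrable_finsetSum _ fun a _ => integrable_symNoise_sq _)
          (memLp_noiseNorm hq).integrable_sq fun X => he X.ofLp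

lemma pow_max_mul_le_integral_noiseNorm_sq [NeZero n] (hq : q ≤ k) :
    (n : ℝ) ^ max q (k - q) * ((k : ℝ) / n / k !) ≤
      ∫ X, noiseNorm q X.ofLp ^ 2 ∂(stdGaussian (TensorSpace k n)) := by
  rcases max_choice q (k - q) with h | h <;> rw [h]
  · simpa using card_mul_le_integral_noiseNorm_sq hq (fun a => unfoldIndex a 0) fun X =>
      sum_sq_col_le_opNorm_sq (unfolding q (symNoise X)) 0
  · simpa using card_mul_le_integral_noiseNorm_sq hq (unfoldIndex 0) fun X =>
      sum_sq_row_le_opNorm_sq (unfolding q (symNoise X)) 0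

lemma sqrt_mul_one_sub_le {a x m : ℝ} (ha : 0 ≤ a) (hx : 0 ≤ x) (hm : 0 ≤ m)
    (h : a * (1 - x) ≤ m ^ 2) : √a * (1 - x) ≤ m := by
  rcases le_total (1 - x) 0 with hneg | hpos
  · exact (mul_nonpos_of_nonneg_of_nonpos (Real.sqrt_nonneg _) hneg).trans hm
  · refine (pow_le_pow_iff_left₀ (by positivity) hm two_ne_zero).1 ?_
    rw [mul_pow, Real.sq_sqrt ha]
    nlinarith [mul_nonneg (mul_nonneg ha hpos) hx]

theorem le_integral_noiseNorm [NeZero n] (hq : q ≤ k) :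
    √((n : ℝ) ^ max q (k - q) * ((k : ℝ) / n / k !)) * (1 - k ! / (n : ℝ) ^ max q (k - q)) ≤
      ∫ X, noiseNorm q X.ofLp ∂(stdGaussian (TensorSpace k n)) := by
  refine sqrt_mul_one_sub_le (by positivity) (by positivity)
    (integral_nonneg fun X => opNorm_nonneg _) ?_
  have hn : (0 : ℝ) < n := by exact_mod_cast NeZero.pos n
  have hcancel : (n : ℝ) ^ max q (k - q) * ((k : ℝ) / n / k !) *
      (k ! / (n : ℝ) ^ max q (k - q)) = k / n := by field_simp
  rw [mul_sub, mul_one, hcancel]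
  linarith [integral_noiseNorm_sq_le (n := n) hq, pow_max_mul_le_integral_noiseNorm_sq (n := n) hq]

end LowerBound

section Bounds

variable {k n q : ℕ}

lemma rpow_sub_one_div_two {x : ℝ} (hx : 0 < x) (m : ℕ) :
    x ^ (((m : ℝ) - 1) / 2) = √(x ^ m / x) := by
  rw [Real.sqrt_eq_rpow, ← Real.rpow_natCast, ← Real.rpow_sub_one hx.ne', ← Real.rpow_mul hx.le]
  congr 1
  ring

lemma lowerBound_eq_sqrt_mul [NeZero n] (hk : 1 ≤ k) (hq : q ≤ k) (C : ℝ) :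
    lowerBound C k n q = √((n : ℝ) ^ max q (k - q) * ((k : ℝ) / n / k !)) *
      (1 - C / (n : ℝ) ^ max q (k - q)) := by
  have hmax : max (q : ℝ) ((k : ℝ) - q) = (max q (k - q) : ℕ) := by
    rw [Nat.cast_max, Nat.cast_sub hq]
  have hfactorial : (k ! : ℝ) = k * (k - 1)! := by
    exact_mod_cast (Nat.mul_factorial_pred (by omega)).symm
  have hscale : (n : ℝ) ^ max q (k - q) * ((k : ℝ) / n / k !) =
      (n : ℝ) ^ max q (k - q) / n / (k - 1)! := by
    rw [hfactorial]
    field_simp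
  rw [lowerBound, max_sub_sub_right, hmax, rpow_sub_one_div_two (by exact_mod_cast NeZero.pos n),
    Real.rpow_natCast, hscale, Real.sqrt_div' _ (by positivity : (0 : ℝ) ≤ (k - 1)!)]
  ring

lemma upperBound_eq_sqrt_mul [NeZero n] (hq : q ≤ k) :
    upperBound k n q = √((k : ℝ) / n) * (√((n : ℝ) ^ q) + √((n : ℝ) ^ (k - q))) := by
  have hn : (0 : ℝ) < n := by exact_mod_cast NeZero.pos n
  rw [upperBound, ← Nat.cast_sub hq, rpow_sub_one_div_two hn, rpow_sub_one_div_two hn]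
  simp only [Real.sqrt_div' _ hn.le]
  ring

lemma ceil_half (k : ℕ) : ⌈(k : ℝ) / 2⌉₊ = (k + 1) / 2 := by
  rcases Nat.even_or_odd' k with ⟨m, rfl | rfl⟩
  · have hhalf : ((2 * m : ℕ) : ℝ) / 2 = (m : ℕ) := by push_cast; ring
    rw [hhalf, Nat.ceil_natCast]
    omega
  · have hhalf : (2 * m + 1 + 1) / 2 = m + 1 := by omega
    rw [hhalf, Nat.ceil_eq_iff (by omega)]
    push_cast
    constructor <;> linarith

lemma isMinOn_lowerBound [NeZero n] {C : ℝ} (hC : 0 ≤ C) (hCn : C ≤ n) (hk : 1 ≤ k) :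
    IsMinOn (fun q : ℕ => lowerBound C k n q) (Set.Iic k) ⌈(k : ℝ) / 2⌉₊ := by
  intro q (hq : q ≤ k)
  have hn : (1 : ℝ) ≤ n := by exact_mod_cast NeZero.one_le
  simp only [Set.mem_ofPred_eq]
  rw [ceil_half, lowerBound_eq_sqrt_mul hk (by omega), lowerBound_eq_sqrt_mul hk hq]
  set M := max q (k - q)
  set m := max ((k + 1) / 2) (k - (k + 1) / 2)
  have hmM : m ≤ M := by omega
  have hpow : (n : ℝ) ^ m ≤ (n : ℝ) ^ M := pow_le_pow_right₀ hn hmM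
  have hself : (n : ℝ) ≤ (n : ℝ) ^ m := le_self_pow₀ hn (by omega)
  have hfactor : 0 ≤ 1 - C / (n : ℝ) ^ m := by
    rw [sub_nonneg, div_le_one (by positivity)]
    exact hCn.trans hself
  gcongr

lemma pow_add_pow_le_pow_add_pow {r : ℝ} (hr : 1 ≤ r) {a b c d : ℕ} (hsum : a + b = c + d)
    (hbd : b ≤ d) (had : a ≤ d) : r ^ a + r ^ b ≤ r ^ c + r ^ d := by
  obtain ⟨e, rfl⟩ := Nat.exists_eq_add_of_le hbd
  obtain rfl : a = c + e := by omega
  have he : 1 ≤ r ^ e := one_le_pow₀ hr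
  have hcb : r ^ c ≤ r ^ b := pow_le_pow_right₀ hr (by omega)
  rw [pow_add, pow_add]
  nlinarith

lemma isMinOn_upperBound [NeZero n] :
    IsMinOn (fun q : ℕ => upperBound k n q) (Set.Iic k) ⌈(k : ℝ) / 2⌉₊ := by
  intro q (hq : q ≤ k)
  have hsqrt : 1 ≤ √(n : ℝ) := Real.one_le_sqrt.2 (by exact_mod_cast NeZero.one_le)
  simp only [Set.mem_ofPred_eq]
  rw [ceil_half, upperBound_eq_sqrt_mul (by omega), upperBound_eq_sqrt_mul hq]
  have hsqrt_pow : ∀ m : ℕ, √((n : ℝ) ^ m) = √(n : ℝ) ^ m := fun m => by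
    rw [Real.sqrt_eq_iff_mul_self_eq (by positivity) (by positivity), ← mul_pow,
      Real.mul_self_sqrt (by positivity)]
  simp only [hsqrt_pow]
  refine mul_le_mul_of_nonneg_left ?_ (Real.sqrt_nonneg _)
  rcases le_total q (k - q) with hle | hle
  · exact pow_add_pow_le_pow_add_pow hsqrt (by omega) (by omega) (by omega)
  · rw [add_comm (√(n : ℝ) ^ q)]
    exact pow_add_pow_le_pow_add_pow hsqrt (by omega) (by omega) (by omega)

end Bounds

section Law

variable {Ω : Type*} [MeasurableSpace Ω] {P : Measure Ω} [IsProbabilityMeasure P] {k n q : ℕ}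
  {G : Ω → Tensor k n}

lemma IsStdGaussianTensor.hasLaw_toLp (hG : IsStdGaussianTensor G P) :
    HasLaw (fun ω => (WithLp.toLp 2 (G ω) : TensorSpace k n)) (stdGaussian (TensorSpace k n))
      P := by
  have hentry : ∀ i, AEMeasurable (fun ω => G ω i) P := fun i => (hG.hasLaw i).aemeasurable
  have hmeas : AEMeasurable G P := aemeasurable_pi_lambda _ hentry
  have hmap : P.map G = Measure.pi fun _ => gaussianReal 0 1 := by
    have hpi := (iIndepFun_iff_map_fun_eq_pi_map hentry).1 hG.indep
    simpa only [(hG.hasLaw _).map_eq] using hpi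
  refine ⟨by fun_prop, ?_⟩
  rw [← map_pi_eq_stdGaussian, ← hmap, AEMeasurable.map_map_of_aemeasurable (by fun_prop) hmeas]
  rfl

variable [NeZero n]

lemma IsStdGaussianTensor.integrable_noiseNorm (hG : IsStdGaussianTensor G P) (hq : q ≤ k) :
    Integrable (fun ω => noiseNorm q (G ω)) P := by
  have hint := TensorUnfolding.integrable_noiseNorm (n := n) hq
  rw [← hG.hasLaw_toLp.map_eq] at hint
  exact hint.comp_aemeasurable hG.hasLaw_toLp.aemeasurable

lemma IsStdGaussianTensor.integral_noiseNorm (hG : IsStdGaussianTensor G P) (hq : q ≤ k) :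
    ∫ ω, noiseNorm q (G ω) ∂P = ∫ X, noiseNorm q X.ofLp ∂(stdGaussian (TensorSpace k n)) :=
  hG.hasLaw_toLp.integral_comp (TensorUnfolding.integrable_noiseNorm hq).aestronglyMeasurable

lemma IsStdGaussianTensor.measureReal_abs_noiseNorm_sub_ge_le (hG : IsStdGaussianTensor G P)
    (hq : q ≤ k) {t : ℝ} (ht : 0 ≤ t) :
    P.real {ω | t ≤ |noiseNorm q (G ω) - ∫ ω', noiseNorm q (G ω') ∂P|} ≤
      2 * Real.exp (-((n : ℝ) * t ^ 2 / (2 * (k : ℝ)))) := by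
  have hsub := hasSubgaussianMGF_noiseNorm (n := n) hq
  rw [← hG.integral_noiseNorm hq, ← hG.hasLaw_toLp.map_eq] at hsub
  refine (measureReal_abs_ge_le_of_hasSubgaussianMGF
    (HasSubgaussianMGF.of_map hG.hasLaw_toLp.aemeasurable hsub) ht).trans_eq ?_
  congr 2
  simp only [NNReal.coe_div, NNReal.coe_natCast]
  field_simp

end Law

end TensorUnfolding

theorem mainTheorem8 (k : ℕ) (hk : 1 ≤ k) :
    ∃ C : ℝ, 0 < C ∧
      (∀ n : ℕ, 1 ≤ n → ∀ (Ω : Type*) [MeasurableSpace Ω] (P : Measure Ω) [IsProbabilityMeasure P]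
        (G : Ω → TensorUnfolding.Tensor k n), TensorUnfolding.IsStdGaussianTensor G P →
        ∀ q : ℕ, q ≤ k →
          Integrable (fun ω => TensorUnfolding.noiseNorm q (G ω)) P ∧
          TensorUnfolding.lowerBound C k n q ≤ ∫ ω, TensorUnfolding.noiseNorm q (G ω) ∂P ∧
          ∫ ω, TensorUnfolding.noiseNorm q (G ω) ∂P ≤ TensorUnfolding.upperBound k n q ∧
          ∀ t : ℝ, 0 ≤ t →
            P.real {ω | t ≤ |TensorUnfolding.noiseNorm q (G ω) -
                ∫ ω', TensorUnfolding.noiseNorm q (G ω') ∂P|} ≤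
              2 * Real.exp (-((n : ℝ) * t ^ 2 / (2 * (k : ℝ))))) ∧
      (∀ᶠ n : ℕ in atTop,
        IsMinOn (fun q : ℕ => TensorUnfolding.lowerBound C k n q) (Set.Iic k) ⌈(k : ℝ) / 2⌉₊ ∧
        IsMinOn (fun q : ℕ => TensorUnfolding.upperBound k n q) (Set.Iic k) ⌈(k : ℝ) / 2⌉₊) := by
  refine ⟨k !, by positivity, fun n hn Ω _ P _ G hG q hq => ?_, ?_⟩
  · have : NeZero n := ⟨by omega⟩
    refine ⟨hG.integrable_noiseNorm hq, ?_, ?_,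
      fun t => hG.measureReal_abs_noiseNorm_sub_ge_le hq⟩
    · rw [hG.integral_noiseNorm hq, TensorUnfolding.lowerBound_eq_sqrt_mul hk hq]
      exact TensorUnfolding.le_integral_noiseNorm hq
    · rw [hG.integral_noiseNorm hq, TensorUnfolding.upperBound_eq_sqrt_mul hq]
      exact TensorUnfolding.integral_noiseNorm_le hq
  · filter_upwards [eventually_ge_atTop 1, eventually_ge_atTop k !] with n hn hkn
    have : NeZero n := ⟨by omega⟩
    exact ⟨TensorUnfolding.isMinOn_lowerBound (by positivity) (by exact_mod_cast hkn) hk,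
      TensorUnfolding.isMinOn_upperBound⟩
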